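/- **Setting.** Let $\psi_1\equiv 1$, $\psi_{2i}(s)=\sqrt2\cos(2\pi i s)$, $\psi_{2i+1}(s)=\sqrt2\sin(2\pi i s)$ ($i\ge1$) be the trigonometric basis of $L^2[0,1]$, with inner product $\langle\cdot,\cdot\rangle$. For a positive sequence $w=(w_j)_{j\ge1}$ put $\|f\|_w^2=\sum_{j\ge1}w_j\langle f,\psi_j\rangle^2$. For real $p\ge 0$ and $\rho>0$ let $W_p^\rho=\{f\in L^2[0,1]:\|f\|_{w^p}^2\le\rho\}$, where $w^p_1=1$ and $w^p_{2i}=w^p_{2i+1}=i^{2p}$ for $i\ge1$. We write $a_n\lesssim b_n$ if for some $C>0$ we have $a_n\le C\,b_n$ for all sufficiently large $n$, and $a_n\sim b_n$ if $a_n\lesssim b_n$ and $b_n\lesssim a_n$. Fix $\sigma>0$, $d\ge1$, $\eta\ge1$, an integer $k\ge4$, and a positive sequence $\upsilon=(\upsilon_j)_{j\ge1}$. Let $X$ be a centered random function in $L^2[0,1]$ with $E\|X\|^2<\infty$, second order stationary, i.e. $\mathrm{Cov}(X(t),X(s))=c(t-s)$ for $s,t\in[0,1]$ and some function $c$ on $[-1,1]$,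 whose covariance operator $T$ is strictly positive and has the trigonometric functions as eigenfunctions, $T\psi_j=\lambda_j\psi_j$ for $j\ge 1$, with eigenvalues satisfying $1/d\le\lambda_j/\upsilon_j\le d$ for all $j\ge1$, and such that $\sup_j E|\langle X,\psi_j\rangle/\sqrt{\lambda_j}|^{4k}\le\eta$. Let $\epsilon$ be a real random variable, uncorrelated with $X$, with mean $0$, variance $1$ and $E|\epsilon|^{4k}\le\eta$. Let $(X_1,\epsilon_1),\dots,(X_n,\epsilon_n)$ be independent copies of $(X,\epsilon)$ and, for $\beta\in L^2[0,1]$, let $Y_i=\langle\beta,X_i\rangle+\sigma\epsilon_i$. With $$\hat g_j=\frac1n\sum_{i=1}^nY_i\langle X_i,\psi_j\rangle,\qquad \hat\lambda_j=\frac1n\sum_{i=1}^n\langle X_i,\psi_j\rangle^2,$$ consider the estimator $$\hat\beta=\sum_{j=1}^{m}\frac{\hat g_j}{\hat\lambda_j}\,\mathbf 1\{\hat\lambda_j\ge\alpha\}\,\psi_j,\qquad m=m(n)\in\mathbb N,\ \alpha=\alpha(n).$$ **Proposition.** Let $\alpha\sim 1/n$. (i) Polynomial case: let $\upsilon_1=1$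 and $\upsilon_j=j^{-2a}$ for $j\ge2$, with $a>1/2$. If $m\sim n^{1/(2p+2a+1)}$, then $$\sup_{\beta\in W_p^\rho}E\langle T(\hat\beta-\beta),\hat\beta-\beta\rangle\ \lesssim\ n^{-(2p+2a)/(2p+2a+1)}.$$ (ii) Exponential case: let $\upsilon_1=1$ and $\upsilon_j=\exp(-j^{2a})$ for $j\ge2$, with $a>0$. If $m\sim(\log n)^{1/(2a)}$ and moreover, for some $\triangle\ge1$ and all sufficiently large $n$, $$\frac1\triangle\ \le\ \frac{w^p_{m+1}\,(m+1)}{n\,\upsilon_{m+1}}$$ (for example $m=\lfloor(\log n)^{1/(2a)}\rfloor$ or $m=\lceil(\log n)^{1/(2a)}\rceil$), then $$\sup_{\beta\in W_p^\rho}E\langle T(\hat\beta-\beta),\hat\beta-\beta\rangle\ \lesssim\ n^{-1}(\log n)^{1/(2a)}.$$ In both parts the constant in $\lesssim$, and the index from which the bound holds, depend on $p,\rho,\sigma,d,\eta,k,a$ and the sequences $m,\alpha$ only, not on the joint law of $(X,\epsilon)$. -/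

import Mathlib

open MeasureTheory ProbabilityTheory Filter
open scoped ENNReal

universe u

namespace FLM

noncomputable section

/-- Lebesgue measure on `[0,1]`. -/
abbrev unitVol : Measure ℝ := volume.restrict (Set.Icc (0 : ℝ) 1)

/-- The real Hilbert space `L²[0,1]`. -/
abbrev L2 : Type := Lp ℝ 2 unitVol

instance instMeasurableSpaceL2 : MeasurableSpace L2 := borel L2

instance instBorelSpaceL2 : BorelSpace L2 := ⟨rfl⟩

/-- The trigonometric functions, indexed by `j ≥ 1` (`j = 0` is not used):
`ψ₁ = 1`, `ψ_{2i}(s) = √2 cos(2π i s)`, `ψ_{2i+1}(s) = √2 sin(2π i s)` for `i ≥ 1`. -/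
def trigFun (j : ℕ) (s : ℝ) : ℝ :=
  if j ≤ 1 then 1
  else if Even j then √2 * Real.cos (2 * Real.pi * ((j / 2 : ℕ) : ℝ) * s)
  else √2 * Real.sin (2 * Real.pi * ((j / 2 : ℕ) : ℝ) * s)

theorem continuous_trigFun (j : ℕ) : Continuous (trigFun j) := by
  unfold trigFun
  split_ifs <;> fun_prop

theorem memLp_trigFun (j : ℕ) : MemLp (trigFun j) 2 unitVol :=
  MemLp.of_bound (continuous_trigFun j).aestronglyMeasurable (√2) (by
    refine Eventually.of_forall fun s => ?_
    have h1 : (1 : ℝ) ≤ √2 := Real.one_le_sqrt.2 (by norm_num)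
    have h0 : (0 : ℝ) ≤ √2 := Real.sqrt_nonneg 2
    unfold trigFun
    split_ifs
    · simp [h1]
    · rw [norm_mul, Real.norm_of_nonneg h0]
      exact mul_le_of_le_one_right h0 (Real.abs_cos_le_one _)
    · rw [norm_mul, Real.norm_of_nonneg h0]
      exact mul_le_of_le_one_right h0 (Real.abs_sin_le_one _))

/-- The trigonometric basis `(ψ_j)_{j ≥ 1}` of `L²[0,1]`. -/
def psi (j : ℕ) : L2 := (memLp_trigFun j).toLp (trigFun j)

/-- The weighted squared norm `‖f‖_w² = ∑_{j ≥ 1} w_j ⟨f, ψ_j⟩²`, with values in `[0,∞]`. -/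
def weightedNormSq (w : ℕ → ℝ) (f : L2) : ℝ≥0∞ :=
  ∑' j : ℕ, ENNReal.ofReal (w (j + 1) * (inner ℝ f (psi (j + 1))) ^ 2)

/-- The ellipsoid `{f ∈ L²[0,1] : ‖f‖_w² ≤ ρ}`. -/
def ellipsoid (w : ℕ → ℝ) (ρ : ℝ) : Set L2 :=
  {f | weightedNormSq w f ≤ ENNReal.ofReal ρ}

/-- The weights `w^p`: `w₁ = 1` and `w_{2i} = w_{2i+1} = i^{2p}` for `i ≥ 1`. -/
def sobolevWeight (p : ℝ) (j : ℕ) : ℝ :=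
  if j ≤ 1 then 1 else ((j / 2 : ℕ) : ℝ) ^ (2 * p)

/-- The ellipsoid `W_p^ρ` in the Sobolev space of periodic functions
(an ellipsoid in `L²[0,1]` if `p = 0`). -/
def sobolevEllipsoid (p ρ : ℝ) : Set L2 := ellipsoid (sobolevWeight p) ρ

/-- Polynomially decreasing weights: `υ₁ = 1` and `υ_j = j^{-2a}` for `j ≥ 2`. -/
def polyWeight (a : ℝ) (j : ℕ) : ℝ :=
  if j ≤ 1 then 1 else (j : ℝ) ^ (-(2 * a))

/-- Exponentially decreasing weights: `υ₁ = 1` and `υ_j = exp(-j^{2a})` for `j ≥ 2`. -/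
def expWeight (a : ℝ) (j : ℕ) : ℝ :=
  if j ≤ 1 then 1 else Real.exp (-((j : ℝ) ^ (2 * a)))

/-- The link condition `1/d ≤ λ_j / υ_j ≤ d` for all `j ≥ 1`. -/
def LinkCondition (υ : ℕ → ℝ) (d : ℝ) (lam : ℕ → ℝ) : Prop :=
  ∀ j : ℕ, 1 ≤ j → 1 / d ≤ lam j / υ j ∧ lam j / υ j ≤ d

/-- `a_n ≲ b_n`: there is `C > 0` with `a_n ≤ C b_n` for all sufficiently large `n`. -/
def Lesssim (a b : ℕ → ℝ) : Prop :=
  ∃ C : ℝ, 0 < C ∧ ∀ᶠ n in atTop, a n ≤ C * b n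

/-- `a_n ∼ b_n`: both `a_n ≲ b_n` and `b_n ≲ a_n`. -/
def SameOrder (a b : ℕ → ℝ) : Prop := Lesssim a b ∧ Lesssim b a

/-- The quantity `(γ_k / (n ω_k)) ∑_{j=1}^k ω_j / υ_j`, which compares the variance with the
squared bias of a series estimator of dimension `k` based on `n` observations. -/
def balance (γ ω υ : ℕ → ℝ) (n k : ℕ) : ℝ :=
  γ k / (n * ω k) * ∑ j ∈ Finset.Icc 1 k, ω j / υ j

section Model

variable {Ω : Type*} [MeasurableSpace Ω]

/-- The covariance operator of a centered random element `X` of `L²[0,1]`: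
`T f = E[⟨X, f⟩ X]`, i.e. `[T f](s) = ∫ f(t) Cov(X(t), X(s)) dt`. -/
def covOp (P : Measure Ω) (X : Ω → L2) : L2 →L[ℝ] L2 := covarianceOperator (P.map X)

/-- The random function `X` is second order stationary: it has a jointly measurable version
`V` with finite variances and `Cov(V(t), V(s)) = c(t - s)` for all `s, t ∈ [0,1]`.
(The function `c` is then positive definite, being a covariance function.) -/
def SecondOrderStationary (P : Measure Ω) (X : Ω → L2) : Prop :=
  ∃ (V : Ω → ℝ → ℝ) (c : ℝ → ℝ),
    Measurable (Function.uncurry V) ∧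
    (∀ᵐ ω ∂P, V ω =ᵐ[unitVol] (X ω : ℝ → ℝ)) ∧
    (∀ t ∈ Set.Icc (0 : ℝ) 1, MemLp (fun ω => V ω t) 2 P) ∧
    ∀ s ∈ Set.Icc (0 : ℝ) 1, ∀ t ∈ Set.Icc (0 : ℝ) 1,
      cov[fun ω => V ω t, fun ω => V ω s; P] = c (t - s)

/-- `X` is a centered second order stationary random function with finite second moment
and strictly positive covariance operator, whose associated sequence of eigenvalues is `lam`
(`lam j` is the eigenvalue for the eigenfunction `ψ_j`), and the `q`-th absolute moments of the
standardized coefficients `⟨X, ψ_j⟩ / √λ_j` are bounded by `η`. -/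
structure IsRegressor (P : Measure Ω) (X : Ω → L2) (lam : ℕ → ℝ) (q : ℕ) (η : ℝ) : Prop where
  measurable : Measurable X
  memLp : MemLp X 2 P
  centered : ∫ ω, X ω ∂P = 0
  stationary : SecondOrderStationary P X
  strictlyPositive : ∀ f : L2, f ≠ 0 → 0 < inner ℝ (covOp P X f) f
  eigen : ∀ j : ℕ, 1 ≤ j → covOp P X (psi j) = lam j • psi j
  moment : ∀ j : ℕ, 1 ≤ j →
    ∫⁻ ω, ENNReal.ofReal (|inner ℝ (X ω) (psi j) / √(lam j)| ^ q) ∂P ≤ ENNReal.ofReal η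

/-- `ε` is centered with variance one and `q`-th absolute moment at most `η`. -/
structure IsError (P : Measure Ω) (ε : Ω → ℝ) (q : ℕ) (η : ℝ) : Prop where
  measurable : Measurable ε
  memLp : MemLp ε 2 P
  centered : ∫ ω, ε ω ∂P = 0
  variance_one : Var[ε; P] = 1
  moment : ∫⁻ ω, ENNReal.ofReal (|ε ω| ^ q) ∂P ≤ ENNReal.ofReal η

/-- The random function `X` and the real random variable `ε` are uncorrelated. -/
def Uncorrelated (P : Measure Ω) (X : Ω → L2) (ε : Ω → ℝ) : Prop :=
  ∀ f : L2, cov[fun ω => inner ℝ (X ω) f, ε; P] = 0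

/-- `(Xs i, εs i)`, `i < n`, are independent copies of `(X, ε)`. -/
structure IsSample (P : Measure Ω) (X : Ω → L2) (ε : Ω → ℝ) {n : ℕ}
    (Xs : Fin n → Ω → L2) (εs : Fin n → Ω → ℝ) : Prop where
  indep : iIndepFun (fun (i : Fin n) ω => (Xs i ω, εs i ω)) P
  identDistrib : ∀ i : Fin n,
    IdentDistrib (fun ω => (Xs i ω, εs i ω)) (fun ω => (X ω, ε ω)) P P

end Model

/-- The response `Y = ⟨β, x⟩ + σ e` of the functional linear model. -/
def response (β : L2) (σ : ℝ) (x : L2) (e : ℝ) : ℝ := inner ℝ β x + σ * e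

/-- `ĝ_j = (1/n) ∑ᵢ Yᵢ ⟨Xᵢ, ψ_j⟩`. -/
def gHat {n : ℕ} (Y : Fin n → ℝ) (X : Fin n → L2) (j : ℕ) : ℝ :=
  (1 / (n : ℝ)) * ∑ i, Y i * inner ℝ (X i) (psi j)

/-- `λ̂_j = (1/n) ∑ᵢ ⟨Xᵢ, ψ_j⟩²`. -/
def lamHat {n : ℕ} (X : Fin n → L2) (j : ℕ) : ℝ :=
  (1 / (n : ℝ)) * ∑ i, (inner ℝ (X i) (psi j)) ^ 2

open Classical in
/-- The thresholded orthogonal series estimator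
`β̂ = ∑_{j=1}^m (ĝ_j / λ̂_j) 1{λ̂_j ≥ α} ψ_j`, a function of the data `(Yᵢ, Xᵢ)`. -/
def betaHat (m : ℕ) (α : ℝ) {n : ℕ} (Y : Fin n → ℝ) (X : Fin n → L2) : L2 :=
  ∑ j ∈ Finset.Icc 1 m, (if α ≤ lamHat X j then gHat Y X j / lamHat X j else 0) • psi j

/-- The mean prediction error `E⟨T(β̂ - β), β̂ - β⟩`, with values in `[0,∞]` (the integrand is
nonnegative since a covariance operator is positive), of the estimator with dimension `m` and
threshold `α`, when `β` is the slope function and the responses are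
`Yᵢ = ⟨β, Xᵢ⟩ + σ εᵢ`. -/
def meanPredictionError {Ω : Type*} [MeasurableSpace Ω] (P : Measure Ω) (T : L2 →L[ℝ] L2)
    (m : ℕ) (α σ : ℝ) {n : ℕ} (Xs : Fin n → Ω → L2) (εs : Fin n → Ω → ℝ) (β : L2) : ℝ≥0∞ :=
  ∫⁻ ω, ENNReal.ofReal
    (inner ℝ
      (T (betaHat m α (fun i => response β σ (Xs i ω) (εs i ω)) (fun i => Xs i ω) - β))
      (betaHat m α (fun i => response β σ (Xs i ω) (εs i ω)) (fun i => Xs i ω) - β)) ∂P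

/-- Under the moment conditions of order `q` (with bound `η`) and the link condition
`(υ, d)` on the eigenvalues, the mean prediction error of the estimator with dimension `m n` and
threshold `α n` is `≲ rate n`, uniformly over the slope functions in `W_p^ρ`. The constant `C`
and the index `N` do not depend on the slope or on the law of the regressor and the error. -/
def AttainsRate (p ρ σ d η : ℝ) (q : ℕ) (υ : ℕ → ℝ) (m : ℕ → ℕ) (α rate : ℕ → ℝ) : Prop :=
  ∃ C : ℝ, 0 < C ∧ ∃ N : ℕ, ∀ n : ℕ, N ≤ n →
    ∀ (Ω : Type u) [MeasurableSpace Ω] (P : Measure Ω) [IsProbabilityMeasure P]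
      (X : Ω → L2) (ε : Ω → ℝ) (Xs : Fin n → Ω → L2) (εs : Fin n → Ω → ℝ) (lam : ℕ → ℝ),
      IsRegressor P X lam q η → LinkCondition υ d lam → IsError P ε q η →
      Uncorrelated P X ε → IsSample P X ε Xs εs →
      ⨆ β ∈ sobolevEllipsoid p ρ, meanPredictionError P (covOp P X) (m n) (α n) σ Xs εs β
        ≤ ENNReal.ofReal (C * rate n)

end

end FLM

/-!
The covariance operator `T` is diagonal in the trigonometric basis, so the mean prediction error is
`∑ j, λ_j E (β̂_j - β_j)²`, and each coordinate is a scalar problem. Writing `x_i = ⟨X_i, ψ_j⟩`, the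
model reads `Y_i = β_j x_i + U_i`, where the effective noise `U_i` (`coordNoise`) collects the other
coordinates of `β` and the error. Hence `ĝ_j = S + β_j λ̂_j`, with `S` the average of the variables
`U_i x_i`. These are centered, because the coordinates of `X` are uncorrelated with each other and
with the error.

If `λ̂_j` exceeds both `α` and `λ_j / 2`, the weighted squared error `λ_j (S / λ̂_j)²` is at most
`4 S² / λ_j`, whose expectation is of order `1 / n`, by fourth moments of `U` and `X`. The event
`λ̂_j ≤ λ_j / 2` has exponentially small probability: `λ̂_j` is an average of nonnegative variables,
so second moments of the summands suffice (`measureReal_mean_le_half`). On this event the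
Cauchy–Schwarz bound `S² ≤ λ̂_j · (1 / n) ∑ U_i²` and `λ̂_j ≥ α ~ 1 / n` lose only a factor of order
`n`. Finally, the loss `λ_j β_j² P(λ̂_j < α)` below the threshold is at most `2 α β_j²` when
`λ_j < 2 α`, and exponentially small otherwise. These bounds make up
`lintegral_sq_threshold_error_le`.

Summing over `j`, the risk is at most a constant times `m / n + 1 / n` plus the bias
`∑_{j > m} λ_j β_j² ≤ d ρ υ_{m+1} / w_{m+1}` (`meanPredictionError_le`, `attainsRate_of_bounds`). The
constants depend on the law of the data only through `η` and a bound for the trace of `T`, which the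
link condition provides. In the polynomial case the bias is of the stated order by the choice of
`m`; in the exponential case the condition on `balance` bounds it by a multiple of `(m + 1) / n`.
-/

namespace FLM

/-! ### The trigonometric basis -/

theorem integral_cos_two_pi_mul (k : ℤ) :
    ∫ s in (0 : ℝ)..1, Real.cos (2 * Real.pi * k * s) = if k = 0 then 1 else 0 := by
  split_ifs with h
  · simp [h]
  · have hk : 2 * Real.pi * (k : ℝ) ≠ 0 := by
      have : (k : ℝ) ≠ 0 := by exact_mod_cast h
      positivity
    rw [intervalIntegral.integral_comp_mul_left (fun x => Real.cos x) hk, integral_cos]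
    have : Real.sin (2 * Real.pi * k) = 0 := by
      have := Real.sin_int_mul_pi (2 * k)
      push_cast at this
      rw [← this]; ring_nf
    simp [this]

theorem integral_sin_two_pi_mul (k : ℤ) :
    ∫ s in (0 : ℝ)..1, Real.sin (2 * Real.pi * k * s) = 0 := by
  rcases eq_or_ne k 0 with rfl | h
  · simp
  · have hk : 2 * Real.pi * (k : ℝ) ≠ 0 := by
      have : (k : ℝ) ≠ 0 := by exact_mod_cast h
      positivity
    rw [intervalIntegral.integral_comp_mul_left (fun x => Real.sin x) hk, integral_sin]
    have : Real.cos (2 * Real.pi * k) = 1 := by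
      rw [← Real.cos_int_mul_two_pi k]; ring_nf
    simp [this]

theorem integral_cos_mul_cos (a b : ℕ) :
    ∫ s in (0 : ℝ)..1, Real.cos (2 * Real.pi * a * s) * Real.cos (2 * Real.pi * b * s) =
      ((if a = b then 1 else 0) + if a + b = 0 then 1 else 0) / 2 := by
  have h : ∀ s : ℝ, Real.cos (2 * Real.pi * a * s) * Real.cos (2 * Real.pi * b * s) =
      (Real.cos (2 * Real.pi * ((a - b : ℤ) : ℝ) * s) +
        Real.cos (2 * Real.pi * ((a + b : ℤ) : ℝ) * s)) * (1 / 2) := by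
    intro s
    push_cast
    rw [show 2 * Real.pi * ((a : ℝ) - b) * s = 2 * Real.pi * a * s - 2 * Real.pi * b * s by ring,
      show 2 * Real.pi * ((a : ℝ) + b) * s = 2 * Real.pi * a * s + 2 * Real.pi * b * s by ring,
      Real.cos_sub, Real.cos_add]
    ring
  simp_rw [h]
  rw [intervalIntegral.integral_mul_const, intervalIntegral.integral_add
    (by apply Continuous.intervalIntegrable; fun_prop)
    (by apply Continuous.intervalIntegrable; fun_prop),
    integral_cos_two_pi_mul, integral_cos_two_pi_mul]
  have h1 : ((a : ℤ) - b = 0) ↔ a = b := by omega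
  have h2 : ((a : ℤ) + b = 0) ↔ a + b = 0 := by omega
  simp only [h1, h2]
  ring

theorem integral_sin_mul_sin (a b : ℕ) :
    ∫ s in (0 : ℝ)..1, Real.sin (2 * Real.pi * a * s) * Real.sin (2 * Real.pi * b * s) =
      ((if a = b then 1 else 0) - if a + b = 0 then 1 else 0) / 2 := by
  have h : ∀ s : ℝ, Real.sin (2 * Real.pi * a * s) * Real.sin (2 * Real.pi * b * s) =
      (Real.cos (2 * Real.pi * ((a - b : ℤ) : ℝ) * s) -
        Real.cos (2 * Real.pi * ((a + b : ℤ) : ℝ) * s)) * (1 / 2) := by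
    intro s
    push_cast
    rw [show 2 * Real.pi * ((a : ℝ) - b) * s = 2 * Real.pi * a * s - 2 * Real.pi * b * s by ring,
      show 2 * Real.pi * ((a : ℝ) + b) * s = 2 * Real.pi * a * s + 2 * Real.pi * b * s by ring,
      Real.cos_sub, Real.cos_add]
    ring
  simp_rw [h]
  rw [intervalIntegral.integral_mul_const, intervalIntegral.integral_sub
    (by apply Continuous.intervalIntegrable; fun_prop)
    (by apply Continuous.intervalIntegrable; fun_prop),
    integral_cos_two_pi_mul, integral_cos_two_pi_mul]
  have h1 : ((a : ℤ) - b = 0) ↔ a = b := by omega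
  have h2 : ((a : ℤ) + b = 0) ↔ a + b = 0 := by omega
  simp only [h1, h2]
  ring

theorem integral_sin_mul_cos (a b : ℕ) :
    ∫ s in (0 : ℝ)..1, Real.sin (2 * Real.pi * a * s) * Real.cos (2 * Real.pi * b * s) = 0 := by
  have h : ∀ s : ℝ, Real.sin (2 * Real.pi * a * s) * Real.cos (2 * Real.pi * b * s) =
      (Real.sin (2 * Real.pi * ((a - b : ℤ) : ℝ) * s) +
        Real.sin (2 * Real.pi * ((a + b : ℤ) : ℝ) * s)) * (1 / 2) := by
    intro s
    push_cast
    rw [show 2 * Real.pi * ((a : ℝ) - b) * s = 2 * Real.pi * a * s - 2 * Real.pi * b * s by ring,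
      show 2 * Real.pi * ((a : ℝ) + b) * s = 2 * Real.pi * a * s + 2 * Real.pi * b * s by ring,
      Real.sin_sub, Real.sin_add]
    ring
  simp_rw [h]
  rw [intervalIntegral.integral_mul_const, intervalIntegral.integral_add
    (by apply Continuous.intervalIntegrable; fun_prop)
    (by apply Continuous.intervalIntegrable; fun_prop),
    integral_sin_two_pi_mul, integral_sin_two_pi_mul]
  simp

/-- Every `j ≥ 1` is `1`, an even number `2 i` or an odd number `2 i + 1` with `i ≥ 1`. -/
theorem trigFun_cases {j : ℕ} (hj : 1 ≤ j) :
    (j = 1 ∧ trigFun j = fun _ => 1) ∨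
      (∃ i, 1 ≤ i ∧ j = 2 * i ∧ trigFun j = fun s => √2 * Real.cos (2 * Real.pi * i * s)) ∨
      ∃ i, 1 ≤ i ∧ j = 2 * i + 1 ∧ trigFun j = fun s => √2 * Real.sin (2 * Real.pi * i * s) := by
  rcases hj.eq_or_lt with rfl | h
  · exact Or.inl ⟨rfl, by ext; simp [trigFun]⟩
  right
  rcases Nat.even_or_odd' j with ⟨i, rfl | rfl⟩
  · refine Or.inl ⟨i, by omega, rfl, ?_⟩
    ext s
    simp [trigFun, show ¬ 2 * i ≤ 1 by omega]
  · refine Or.inr ⟨i, by omega, rfl, ?_⟩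
    ext s
    simp [trigFun, show ¬ 2 * i + 1 ≤ 1 by omega, show (2 * i + 1) / 2 = i by omega]

theorem integral_trigFun_mul_trigFun {j l : ℕ} (hj : 1 ≤ j) (hl : 1 ≤ l) :
    ∫ s in (0 : ℝ)..1, trigFun j s * trigFun l s = if j = l then 1 else 0 := by
  have h2 : √2 * √2 = (2 : ℝ) := Real.mul_self_sqrt (by norm_num)
  have hcos (i : ℕ) (hi : 1 ≤ i) : ∫ s in (0 : ℝ)..1, Real.cos (2 * Real.pi * i * s) = 0 := by
    have := integral_cos_two_pi_mul i
    rw [if_neg (by omega)] at this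
    exact_mod_cast this
  have hsin (i : ℕ) : ∫ s in (0 : ℝ)..1, Real.sin (2 * Real.pi * i * s) = 0 := by
    exact_mod_cast integral_sin_two_pi_mul i
  have hm (x y : ℝ) : √2 * x * (√2 * y) = 2 * (x * y) := by rw [mul_mul_mul_comm, h2]
  have hcs (a b : ℕ) : ∫ s in (0 : ℝ)..1,
      Real.cos (2 * Real.pi * a * s) * Real.sin (2 * Real.pi * b * s) = 0 := by
    simp_rw [mul_comm (Real.cos _)]
    exact integral_sin_mul_cos b a
  rcases trigFun_cases hj with ⟨hj', ej⟩ | ⟨a, ha, hj', ej⟩ | ⟨a, ha, hj', ej⟩ <;>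
  rcases trigFun_cases hl with ⟨hl', el⟩ | ⟨b, hb, hl', el⟩ | ⟨b, hb, hl', el⟩ <;>
  simp only [ej, el, hm, one_mul, mul_one, intervalIntegral.integral_const_mul,
    integral_cos_mul_cos, integral_sin_mul_sin, integral_sin_mul_cos, hcs, hsin, mul_zero]
  · simp [hj', hl']
  · rw [if_neg (by omega), hcos b hb, mul_zero]
  · rw [if_neg (by omega)]
  · rw [if_neg (by omega), hcos a ha, mul_zero]
  · have : j = l ↔ a = b := by omega
    simp only [this, show a + b ≠ 0 by omega, if_false]
    ring
  · rw [if_neg (by omega)]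
  · rw [if_neg (by omega)]
  · rw [if_neg (by omega)]
  · have : j = l ↔ a = b := by omega
    simp only [this, show a + b ≠ 0 by omega, if_false]
    ring

theorem inner_psi_right (f : L2) (j : ℕ) :
    inner ℝ f (psi j) = ∫ s in (0 : ℝ)..1, f s * trigFun j s := by
  rw [intervalIntegral.integral_of_le zero_le_one, ← integral_Icc_eq_integral_Ioc, L2.inner_def]
  refine integral_congr_ae ?_
  filter_upwards [(memLp_trigFun j).coeFn_toLp] with s hs
  simp only [RCLike.inner_apply, conj_trivial, psi]
  rw [hs, mul_comm]

theorem orthonormal_psi : Orthonormal ℝ fun j : ℕ => psi (j + 1) := by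
  rw [orthonormal_iff_ite]
  intro i j
  have h : (inner ℝ (psi (i + 1)) (psi (j + 1)) : ℝ) =
      ∫ s in (0 : ℝ)..1, trigFun (i + 1) s * trigFun (j + 1) s := by
    rw [inner_psi_right, intervalIntegral.integral_of_le zero_le_one,
      intervalIntegral.integral_of_le zero_le_one, ← integral_Icc_eq_integral_Ioc,
      ← integral_Icc_eq_integral_Ioc]
    refine integral_congr_ae ?_
    filter_upwards [(memLp_trigFun (i + 1)).coeFn_toLp] with s hs
    simp only [psi]
    rw [hs]
  rw [h, integral_trigFun_mul_trigFun (by omega) (by omega)]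
  simp

theorem intervalIntegrable_mul_of_continuous (f : L2) {g : ℝ → ℝ} (hg : Continuous g) :
    IntervalIntegrable (fun s => f s * g s) volume 0 1 := by
  have hf : IntervalIntegrable (fun s => f s) volume 0 1 := by
    rw [intervalIntegrable_iff_integrableOn_Icc_of_le zero_le_one]
    exact (Lp.memLp f).integrable (by norm_num)
  exact hf.mul_continuousOn hg.continuousOn

/-- All Fourier coefficients of `f` are combinations of the inner products of `f` with the
trigonometric functions. -/
theorem fourierCoeffOn_eq_zero {f : L2} (hf : ∀ j, 1 ≤ j → inner ℝ f (psi j) = 0) (n : ℤ) :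
    fourierCoeffOn zero_lt_one (fun s => (f s : ℂ)) n = 0 := by
  have h2 : √2 ≠ (0 : ℝ) := by positivity
  have hcosN (i : ℕ) : ∫ s in (0 : ℝ)..1, f s * Real.cos (2 * Real.pi * i * s) = 0 := by
    rcases Nat.eq_zero_or_pos i with rfl | hi
    · have := hf 1 le_rfl
      rw [inner_psi_right] at this
      simpa [trigFun] using this
    · have := hf (2 * i) (by omega)
      rw [inner_psi_right] at this
      simp only [trigFun, show ¬ 2 * i ≤ 1 by omega, if_false, even_two_mul, if_true,
        show 2 * i / 2 = i by omega, mul_left_comm _ (√2), intervalIntegral.integral_const_mul]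
        at this
      simpa using this
  have hsinN (i : ℕ) : ∫ s in (0 : ℝ)..1, f s * Real.sin (2 * Real.pi * i * s) = 0 := by
    rcases Nat.eq_zero_or_pos i with rfl | hi
    · simp
    · have := hf (2 * i + 1) (by omega)
      rw [inner_psi_right] at this
      simp only [trigFun, show ¬ 2 * i + 1 ≤ 1 by omega, if_false,
        show ¬ Even (2 * i + 1) by simp,
        show (2 * i + 1) / 2 = i by omega, mul_left_comm _ (√2),
        intervalIntegral.integral_const_mul] at this
      simpa using this
  have hcos : ∫ s in (0 : ℝ)..1, f s * Real.cos (2 * Real.pi * n * s) = 0 := by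
    obtain ⟨i, rfl | rfl⟩ := n.eq_nat_or_neg
    · exact_mod_cast hcosN i
    · simpa using hcosN i
  have hsin : ∫ s in (0 : ℝ)..1, f s * Real.sin (2 * Real.pi * n * s) = 0 := by
    obtain ⟨i, rfl | rfl⟩ := n.eq_nat_or_neg
    · exact_mod_cast hsinN i
    · simpa using hsinN i
  rw [fourierCoeffOn_eq_integral]
  have h (s : ℝ) : (fourier (-n) (s : AddCircle ((1 : ℝ) - 0)) : ℂ) • (f s : ℂ) =
      ((f s * Real.cos (2 * Real.pi * n * s) : ℝ) : ℂ) +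
        ((f s * Real.sin (2 * Real.pi * n * s) : ℝ) : ℂ) * (-Complex.I) := by
    rw [fourier_coe_apply, show (2 * Real.pi * Complex.I * ((-n : ℤ) : ℂ) * s /
      ((1 - 0 : ℝ) : ℂ) : ℂ) = ((-(2 * Real.pi * n * s) : ℝ) : ℂ) * Complex.I by
        push_cast; ring, Complex.exp_mul_I, ← Complex.ofReal_cos, ← Complex.ofReal_sin,
        Real.cos_neg, Real.sin_neg, smul_eq_mul]
    push_cast
    ring
  simp_rw [h]
  have hc := intervalIntegrable_mul_of_continuous f
    (g := fun s => Real.cos (2 * Real.pi * n * s)) (by fun_prop)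
  have hs := intervalIntegrable_mul_of_continuous f
    (g := fun s => Real.sin (2 * Real.pi * n * s)) (by fun_prop)
  have hof {g : ℝ → ℝ} (hg : IntervalIntegrable g volume 0 1) :
      IntervalIntegrable (fun s => (g s : ℂ)) volume 0 1 := ⟨hg.1.ofReal, hg.2.ofReal⟩
  rw [intervalIntegral.integral_add (hof hc) ((hof hs).mul_const _),
    intervalIntegral.integral_mul_const, intervalIntegral.integral_ofReal,
    intervalIntegral.integral_ofReal, hcos, hsin]
  simp

/-- The trigonometric functions are complete, by Parseval's identity for complex Fourier series. -/
theorem eq_zero_of_inner_psi_eq_zero {f : L2} (hf : ∀ j, 1 ≤ j → inner ℝ f (psi j) = 0) :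
    f = 0 := by
  have hL : MemLp (fun s => (f s : ℂ)) 2 (volume.restrict (Set.Ioc (0 : ℝ) 1)) := by
    rw [restrict_Ioc_eq_restrict_Icc]
    exact (Lp.memLp f).ofReal (K := ℂ)
  have h := hasSum_sq_fourierCoeffOn zero_lt_one hL
  simp only [fourierCoeffOn_eq_zero hf, norm_zero, ne_eq, OfNat.ofNat_ne_zero, not_false_eq_true,
    zero_pow] at h
  have h0 := h.unique hasSum_zero
  rw [← inner_self_eq_zero (𝕜 := ℝ), L2.inner_def]
  rw [intervalIntegral.integral_of_le zero_le_one, ← integral_Icc_eq_integral_Ioc] at h0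
  simpa [pow_two] using h0

/-- The trigonometric functions as a Hilbert basis; the index is shifted to start at `0`. -/
noncomputable def trigBasis : HilbertBasis ℕ ℝ L2 :=
  HilbertBasis.mkOfOrthogonalEqBot orthonormal_psi <| by
    rw [Submodule.eq_bot_iff]
    intro f hf
    refine eq_zero_of_inner_psi_eq_zero fun j hj => ?_
    rw [Submodule.mem_orthogonal'] at hf
    obtain ⟨i, rfl⟩ := Nat.exists_eq_add_of_le' hj
    exact hf _ (Submodule.subset_span ⟨i, rfl⟩)

@[simp]
theorem trigBasis_apply (j : ℕ) : trigBasis j = psi (j + 1) := by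
  simp [trigBasis]

theorem hasSum_sq_inner_psi (f : L2) :
    HasSum (fun j : ℕ => (inner ℝ f (psi (j + 1)) : ℝ) ^ 2) (‖f‖ ^ 2) := by
  have h := trigBasis.hasSum_inner_mul_inner f f
  simp only [trigBasis_apply, real_inner_comm f, real_inner_self_eq_norm_sq, ← pow_two] at h
  simpa only [real_inner_comm f] using h

/-! ### Empirical second moments and a single coordinate of the estimator -/

theorem exp_neg_le_quadratic {y : ℝ} (hy : 0 ≤ y) : Real.exp (-y) ≤ 1 - y + y ^ 2 / 2 := by
  have h := Real.quadratic_le_exp_of_nonneg hy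
  have hpos : 0 < 1 - y + y ^ 2 / 2 := by nlinarith [sq_nonneg (y - 1)]
  rw [Real.exp_neg, inv_le_comm₀ (Real.exp_pos y) hpos]
  refine le_trans ?_ h
  rw [inv_le_iff_one_le_mul₀ hpos]
  nlinarith [sq_nonneg (y ^ 2)]

section Coordinate

variable {Ω : Type*} [MeasurableSpace Ω] {P : Measure Ω} [IsProbabilityMeasure P] {n : ℕ}

/-- The Laplace transform of a nonnegative variable with mean `l` and second moment at most
`M * l ^ 2`, at the point that optimizes the lower tail bound. -/
theorem mgf_le_of_nonneg {Z : Ω → ℝ} {l M : ℝ} (hl : 0 < l) (hM : 0 < M) (hnn : ∀ ω, 0 ≤ Z ω)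
    (hZ : MemLp Z 2 P) (hmean : ∫ ω, Z ω ∂P = l) (hsq : ∫ ω, Z ω ^ 2 ∂P ≤ M * l ^ 2) :
    mgf Z P (-(1 / (2 * M * l))) ≤ Real.exp (-(3 / (8 * M))) := by
  set t := 1 / (2 * M * l) with ht
  have htpos : 0 < t := by positivity
  have hi1 : Integrable (fun ω => 1 - t * Z ω) P :=
    (integrable_const 1).sub ((hZ.integrable (by norm_num)).const_mul t)
  have hi2 : Integrable (fun ω => t ^ 2 / 2 * Z ω ^ 2) P := hZ.integrable_sq.const_mul _
  have h1 : mgf Z P (-t) ≤ ∫ ω, (1 - t * Z ω + t ^ 2 / 2 * Z ω ^ 2) ∂P := by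
    refine integral_mono_of_nonneg (Eventually.of_forall fun ω => (Real.exp_pos _).le) ?_
      (Eventually.of_forall fun ω => ?_)
    · exact hi1.add hi2
    · have := exp_neg_le_quadratic (mul_nonneg htpos.le (hnn ω))
      simp only [neg_mul]
      linarith [mul_pow t (Z ω) 2]
  have h2 : ∫ ω, (1 - t * Z ω + t ^ 2 / 2 * Z ω ^ 2) ∂P =
      1 - t * l + t ^ 2 / 2 * ∫ ω, Z ω ^ 2 ∂P := by
    rw [integral_add hi1 hi2, integral_sub (integrable_const 1)
      ((hZ.integrable (by norm_num)).const_mul t), integral_const_mul, integral_const_mul, hmean]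
    simp
  have h3 : 1 - t * l + t ^ 2 / 2 * ∫ ω, Z ω ^ 2 ∂P ≤ -(3 / (8 * M)) + 1 := by
    have := mul_le_mul_of_nonneg_left hsq (show 0 ≤ t ^ 2 / 2 by positivity)
    have e1 : t * l = 1 / (2 * M) := by rw [ht]; field_simp
    have e2 : t ^ 2 / 2 * (M * l ^ 2) = 1 / (8 * M) := by rw [ht]; field_simp; norm_num
    have e3 : 1 / (2 * M) = 1 / (8 * M) + 3 / (8 * M) := by field_simp; norm_num
    linarith
  exact (h1.trans_eq h2).trans (h3.trans (Real.add_one_le_exp _))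

/-- Nonnegative independent variables concentrate exponentially fast from below as soon as they
have second moments: no higher moments enter the lower tail of their average. -/
theorem measureReal_mean_le_half {Z : Fin n → Ω → ℝ} {l M : ℝ} (hl : 0 < l) (hM : 0 < M)
    (hnn : ∀ i ω, 0 ≤ Z i ω) (hZ : ∀ i, MemLp (Z i) 2 P) (hind : iIndepFun Z P)
    (hmean : ∀ i, ∫ ω, Z i ω ∂P = l) (hsq : ∀ i, ∫ ω, Z i ω ^ 2 ∂P ≤ M * l ^ 2)
    (hn : 0 < n) :
    P.real {ω | 1 / (n : ℝ) * ∑ i, Z i ω ≤ l / 2} ≤ Real.exp (-(n / (8 * M))) := by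
  have hn' : (0 : ℝ) < n := by exact_mod_cast hn
  set t := 1 / (2 * M * l) with ht
  have htpos : 0 < t := by positivity
  have hmeas : AEMeasurable (∑ i, Z i) P :=
    Finset.aemeasurable_sum _ fun i _ => (hZ i).aemeasurable
  have hset : {ω | 1 / (n : ℝ) * ∑ i, Z i ω ≤ l / 2} = {ω | (∑ i, Z i) ω ≤ n * l / 2} := by
    ext ω
    simp only [Set.mem_ofPred_eq, Finset.sum_apply, one_div]
    rw [inv_mul_le_iff₀ hn', mul_div_assoc]
  have hint : Integrable (fun ω => Real.exp (-t * (∑ i, Z i) ω)) P := by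
    refine Integrable.of_bound (C := 1) ?_ (Eventually.of_forall fun ω => ?_)
    · exact (Real.measurable_exp.comp_aemeasurable (hmeas.const_mul _)).aestronglyMeasurable
    · rw [Real.norm_of_nonneg (Real.exp_pos _).le, Real.exp_le_one_iff, Finset.sum_apply]
      have := Finset.sum_nonneg fun i (_ : i ∈ Finset.univ) => hnn i ω
      nlinarith
  have h := measure_le_le_exp_mul_mgf (n * l / 2) (neg_nonpos.2 htpos.le) hint
  rw [hset]
  refine h.trans ?_
  rw [hind.mgf_sum₀ (fun i => (hZ i).aemeasurable)]
  have hprod : ∏ i : Fin n, mgf (Z i) P (-t) ≤ Real.exp (-(3 / (8 * M))) ^ n := by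
    refine (Finset.prod_le_prod (fun i _ => mgf_nonneg) fun i _ =>
      mgf_le_of_nonneg hl hM (hnn i) (hZ i) (hmean i) (hsq i)).trans_eq ?_
    simp
  refine (mul_le_mul_of_nonneg_left hprod (Real.exp_pos _).le).trans_eq ?_
  rw [← Real.exp_nat_mul, ← Real.exp_add]
  congr 1
  rw [ht]
  field_simp
  norm_num

/-- The arithmetic-geometric mean inequality, weighted so that both terms have the same order when
`x ^ 2` is of the order of `l`. -/
theorem sq_mul_sq_le {l u x : ℝ} (hl : 0 < l) :
    (u * x) ^ 2 ≤ l / 2 * u ^ 4 + 1 / (2 * l) * x ^ 4 := by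
  have h : l / 2 * u ^ 4 + 1 / (2 * l) * x ^ 4 - (u * x) ^ 2 =
      1 / (2 * l) * (l * u ^ 2 - x ^ 2) ^ 2 := by field_simp; ring
  have : 0 ≤ 1 / (2 * l) * (l * u ^ 2 - x ^ 2) ^ 2 := by positivity
  linarith

theorem sq_mean_le_mean_sq (a : Fin n → ℝ) :
    (1 / (n : ℝ) * ∑ i, a i) ^ 2 ≤ 1 / (n : ℝ) * ∑ i, a i ^ 2 := by
  rcases Nat.eq_zero_or_pos n with rfl | hn
  · simp
  have hn' : (0 : ℝ) < n := by exact_mod_cast hn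
  have h := sq_sum_le_card_mul_sum_sq (s := Finset.univ) (f := a)
  simp only [Finset.card_univ, Fintype.card_fin] at h
  rw [mul_pow, one_div, inv_pow, inv_mul_le_iff₀ (by positivity)]
  calc _ ≤ _ := h
    _ = _ := by field_simp

theorem sq_mean_mul_le (u x : Fin n → ℝ) :
    (1 / (n : ℝ) * ∑ i, u i * x i) ^ 2 ≤
      (1 / (n : ℝ) * ∑ i, u i ^ 2) * (1 / (n : ℝ) * ∑ i, x i ^ 2) := by
  have h := Finset.sum_mul_sq_le_sq_mul_sq Finset.univ u x
  calc (1 / (n : ℝ) * ∑ i, u i * x i) ^ 2 = (1 / (n : ℝ)) ^ 2 * (∑ i, u i * x i) ^ 2 := by ring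
    _ ≤ (1 / (n : ℝ)) ^ 2 * ((∑ i, u i ^ 2) * ∑ i, x i ^ 2) := by gcongr
    _ = _ := by ring

open Classical in
/-- The error of a thresholded ratio estimator of `b`, where `L` estimates `l` and `S` is the
noise in the numerator: below the threshold the loss is `b ^ 2`; above it, the denominator is
either of the order of `l`, or `L ≤ l / 2` and `S ^ 2 / L` is controlled by `V`. -/
theorem sq_threshold_error_le {l α b S L V : ℝ} (hl : 0 < l) (hα : 0 < α) (hV : 0 ≤ V)
    (hS : S ^ 2 ≤ V * L) :
    l * ((if α ≤ L then (S + b * L) / L else 0) - b) ^ 2 ≤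
      4 / l * S ^ 2 + l / α * (V * (Set.Iic (l / 2)).indicator 1 L) +
        b ^ 2 * (l * (Set.Iio α).indicator 1 L) := by
  have h3 : 0 ≤ b ^ 2 * (l * (Set.Iio α).indicator (1 : ℝ → ℝ) L) :=
    mul_nonneg (sq_nonneg b) (mul_nonneg hl.le (Set.indicator_nonneg (fun _ _ => zero_le_one) _))
  have h2 : 0 ≤ l / α * (V * (Set.Iic (l / 2)).indicator (1 : ℝ → ℝ) L) :=
    mul_nonneg (by positivity) (mul_nonneg hV (Set.indicator_nonneg (fun _ _ => zero_le_one) _))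
  have h1 : 0 ≤ 4 / l * S ^ 2 := by positivity
  by_cases hL : α ≤ L
  · have hLpos : 0 < L := hα.trans_le hL
    rw [if_pos hL, show (S + b * L) / L - b = S / L by field_simp; ring, div_pow]
    by_cases hA : L ≤ l / 2
    · rw [Set.indicator_of_mem (show L ∈ Set.Iic (l / 2) from hA)] at h2 ⊢
      have : l * (S ^ 2 / L ^ 2) ≤ l / α * (V * (1 : ℝ → ℝ) L) := by
        rw [Pi.one_apply, mul_one, div_mul_eq_mul_div, mul_div_assoc]
        refine mul_le_mul_of_nonneg_left ?_ hl.le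
        rw [div_le_div_iff₀ (by positivity) hα]
        calc S ^ 2 * α ≤ (V * L) * L := by gcongr
          _ = V * L ^ 2 := by ring
      linarith
    · push Not at hA
      have : l * (S ^ 2 / L ^ 2) ≤ 4 / l * S ^ 2 := by
        rw [mul_div_assoc', div_mul_eq_mul_div, div_le_div_iff₀ (by positivity) hl]
        nlinarith [mul_nonneg (sq_nonneg S) (show 0 ≤ 4 * L ^ 2 - l ^ 2 by nlinarith)]
      linarith
  · push Not at hL
    rw [if_neg (not_le.2 hL), Set.indicator_of_mem (show L ∈ Set.Iio α from hL)] at *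
    simp only [Pi.one_apply, mul_one, zero_sub, neg_sq] at *
    linarith [mul_comm l (b ^ 2)]

theorem integral_indicator_one_comp {L : Ω → ℝ} (hL : AEMeasurable L P) {s : Set ℝ}
    (hs : MeasurableSet s) :
    Integrable (fun ω => s.indicator (1 : ℝ → ℝ) (L ω)) P ∧
      ∫ ω, s.indicator (1 : ℝ → ℝ) (L ω) ∂P = P.real {ω | L ω ∈ s} := by
  have e : (fun ω => s.indicator (1 : ℝ → ℝ) (L ω)) = (L ⁻¹' s).indicator 1 := by
    ext ω; simp [Set.indicator]; rfl
  have hs' : NullMeasurableSet (L ⁻¹' s) P := hL.nullMeasurable hs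
  rw [e]
  refine ⟨(integrable_const (1 : ℝ)).indicator₀ hs', ?_⟩
  rw [integral_indicator₀ hs']
  simp [Measure.real]
  rfl

open Classical in
/-- The risk of one coordinate of the thresholded estimator. The observations `U i * x i` are
centered, and `b` is the coordinate to be estimated. The three terms are the variance, the
contribution of an exceptionally small denominator, and the loss below the threshold. -/
theorem lintegral_sq_threshold_error_le {x U : Fin n → Ω → ℝ} {l M K α b : ℝ}
    (hl : 0 < l) (hM : 0 < M) (hα : 0 < α) (hn : 0 < n)
    (hind : iIndepFun (fun i ω => (x i ω, U i ω)) P)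
    (hx : ∀ i, MemLp (x i) 4 P) (hU : ∀ i, MemLp (U i) 4 P)
    (h0 : ∀ i, ∫ ω, U i ω * x i ω ∂P = 0) (hx2 : ∀ i, ∫ ω, x i ω ^ 2 ∂P = l)
    (hx4 : ∀ i, ∫ ω, x i ω ^ 4 ∂P ≤ M * l ^ 2) (hU4 : ∀ i, ∫ ω, U i ω ^ 4 ∂P ≤ K) :
    ∫⁻ ω, ENNReal.ofReal (l * ((if α ≤ 1 / (n : ℝ) * ∑ i, x i ω ^ 2 then
        (1 / (n : ℝ) * ∑ i, U i ω * x i ω + b * (1 / (n : ℝ) * ∑ i, x i ω ^ 2)) /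
          (1 / (n : ℝ) * ∑ i, x i ω ^ 2) else 0) - b) ^ 2) ∂P ≤
      ENNReal.ofReal (2 * (K + M) / n + l / α * ((K + 1) / 2 * Real.exp (-(n / (16 * M)))) +
        b ^ 2 * (2 * α + l * Real.exp (-(n / (8 * M))))) := by
  have hn' : (0 : ℝ) < n := by exact_mod_cast hn
  have hxm (i) : AEMeasurable (x i) P := (hx i).aemeasurable
  have hUm (i) : AEMeasurable (U i) P := (hU i).aemeasurable
  have hx4i (i) : Integrable (fun ω => x i ω ^ 4) P := by
    simpa [Even.pow_abs (show Even 4 by decide)] using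
      (hx i).integrable_norm_pow (p := 4) (by norm_num)
  have hU4i (i) : Integrable (fun ω => U i ω ^ 4) P := by
    simpa [Even.pow_abs (show Even 4 by decide)] using
      (hU i).integrable_norm_pow (p := 4) (by norm_num)
  set S : Ω → ℝ := fun ω => 1 / (n : ℝ) * ∑ i, U i ω * x i ω with hSdef
  set L : Ω → ℝ := fun ω => 1 / (n : ℝ) * ∑ i, x i ω ^ 2 with hLdef
  set V : Ω → ℝ := fun ω => 1 / (n : ℝ) * ∑ i, U i ω ^ 2 with hVdef
  have hLm : AEMeasurable L P := by fun_prop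
  have hVnn (ω) : 0 ≤ V ω := by positivity
  -- the variance of the numerator
  have hUx (i) : MemLp (fun ω => U i ω * x i ω) 2 P := by
    have : ENNReal.HolderTriple 4 4 2 := ⟨by
      rw [← ENNReal.toReal_eq_toReal_iff' (by simp) (by simp), ENNReal.toReal_add (by simp)
        (by simp)]
      norm_num⟩
    exact (hx i).mul' (hU i)
  have hUx2 (i) : ∫ ω, (U i ω * x i ω) ^ 2 ∂P ≤ l * (K + M) / 2 := by
    calc ∫ ω, (U i ω * x i ω) ^ 2 ∂P
        ≤ ∫ ω, (l / 2 * U i ω ^ 4 + 1 / (2 * l) * x i ω ^ 4) ∂P :=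
          integral_mono (hUx i).integrable_sq
            (((hU4i i).const_mul _).add ((hx4i i).const_mul _)) fun ω => sq_mul_sq_le hl
      _ = l / 2 * ∫ ω, U i ω ^ 4 ∂P + 1 / (2 * l) * ∫ ω, x i ω ^ 4 ∂P := by
          rw [integral_add ((hU4i i).const_mul _) ((hx4i i).const_mul _), integral_const_mul,
            integral_const_mul]
      _ ≤ l / 2 * K + 1 / (2 * l) * (M * l ^ 2) := by
          gcongr
          · exact hU4 i
          · exact hx4 i
      _ = l * (K + M) / 2 := by field_simp
  have hSmem : MemLp S 2 P := (memLp_finsetSum _ fun i _ => hUx i).const_mul _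
  have hS2 : ∫ ω, S ω ^ 2 ∂P ≤ l * (K + M) / (2 * n) := by
    have hS0 : ∫ ω, S ω ∂P = 0 := by
      simp only [hSdef]
      rw [integral_const_mul, integral_finsetSum _ fun i _ => (hUx i).integrable (by norm_num)]
      simp [h0]
    have hvar : Var[S; P] = (1 / (n : ℝ)) ^ 2 * ∑ i, Var[fun ω => U i ω * x i ω; P] := by
      rw [hSdef, variance_const_mul]
      congr 1
      have := IndepFun.variance_sum (s := Finset.univ) (X := fun i ω => U i ω * x i ω)
        (fun i _ => hUx i) (fun i _ j _ hij => by
          have := hind.comp (fun _ (q : ℝ × ℝ) => q.2 * q.1) (fun _ => by fun_prop)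
          exact this.indepFun hij)
      rw [← this]
      congr 1
      ext ω
      simp
    rw [variance_of_integral_eq_zero hSmem.aemeasurable hS0] at hvar
    rw [hvar]
    calc (1 / (n : ℝ)) ^ 2 * ∑ i, Var[fun ω => U i ω * x i ω; P]
        ≤ (1 / (n : ℝ)) ^ 2 * ∑ _i : Fin n, l * (K + M) / 2 := by
          gcongr with i
          exact (variance_le_expectation_sq (hUx i).aestronglyMeasurable).trans (hUx2 i)
      _ = l * (K + M) / (2 * n) := by
          simp
          field_simp
  -- the lower tail of the denominator
  set δ := Real.exp (-(n / (16 * M))) with hδ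
  have hδpos : 0 < δ := Real.exp_pos _
  have hδ2 : Real.exp (-(n / (8 * M))) = δ ^ 2 := by
    rw [hδ, ← Real.exp_nat_mul]; congr 1; push_cast; field_simp; norm_num
  have htail : P.real {ω | L ω ∈ Set.Iic (l / 2)} ≤ δ ^ 2 := by
    rw [← hδ2]
    refine measureReal_mean_le_half (Z := fun i ω => x i ω ^ 2) hl hM
      (fun i ω => sq_nonneg _) (fun i => ?_) ?_ hx2 (fun i => ?_) hn
    · rw [memLp_two_iff_integrable_sq (by fun_prop)]
      simpa only [← pow_mul] using hx4i i
    · exact hind.comp (fun _ (q : ℝ × ℝ) => q.1 ^ 2) (fun _ => by fun_prop)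
    · simpa only [← pow_mul] using hx4 i
  obtain ⟨hAi, hA⟩ := integral_indicator_one_comp hLm (measurableSet_Iic (a := l / 2))
  obtain ⟨hBi, hB⟩ := integral_indicator_one_comp hLm (measurableSet_Iio (a := α))
  have hV2 (ω) : V ω ^ 2 ≤ 1 / (n : ℝ) * ∑ i, U i ω ^ 4 := by
    have := sq_mean_le_mean_sq fun i => U i ω ^ 2
    simp only [← pow_mul] at this
    exact this
  have hUsum : Integrable (fun ω => 1 / (n : ℝ) * ∑ i, U i ω ^ 4) P :=
    (integrable_finsetSum _ fun i _ => hU4i i).const_mul _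
  -- the weights `δ` and `1 / δ` balance the two terms, since the event has probability `≤ δ ^ 2`
  have hVAle (ω) : V ω * (Set.Iic (l / 2)).indicator 1 (L ω) ≤
      δ / 2 * (1 / (n : ℝ) * ∑ i, U i ω ^ 4) +
        1 / (2 * δ) * (Set.Iic (l / 2)).indicator 1 (L ω) := by
    have hI : (Set.Iic (l / 2)).indicator (1 : ℝ → ℝ) (L ω) ^ 2 =
        (Set.Iic (l / 2)).indicator (1 : ℝ → ℝ) (L ω) := by
      by_cases h : L ω ∈ Set.Iic (l / 2) <;> simp [h]
    set I := (Set.Iic (l / 2)).indicator (1 : ℝ → ℝ) (L ω)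
    have e : δ / 2 * V ω ^ 2 + 1 / (2 * δ) * I ^ 2 - V ω * I =
        1 / (2 * δ) * (δ * V ω - I) ^ 2 := by field_simp; ring
    have : 0 ≤ 1 / (2 * δ) * (δ * V ω - I) ^ 2 := by positivity
    have := mul_le_mul_of_nonneg_left (hV2 ω) (show 0 ≤ δ / 2 by positivity)
    rw [hI] at e
    linarith
  have hVAi : Integrable (fun ω => V ω * (Set.Iic (l / 2)).indicator 1 (L ω)) P := by
    refine Integrable.mono' ((hUsum.const_mul (δ / 2)).add (hAi.const_mul (1 / (2 * δ)))) ?_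
      (Eventually.of_forall fun ω => ?_)
    · have : AEMeasurable V P := by fun_prop
      exact this.aestronglyMeasurable.mul hAi.aestronglyMeasurable
    · refine (Real.norm_of_nonneg (mul_nonneg (hVnn ω)
        (Set.indicator_nonneg (fun _ _ => zero_le_one) _))).trans_le (hVAle ω)
  have hVA : ∫ ω, V ω * (Set.Iic (l / 2)).indicator 1 (L ω) ∂P ≤ (K + 1) / 2 * δ := by
    calc _ ≤ _ := integral_mono hVAi
            ((hUsum.const_mul (δ / 2)).add (hAi.const_mul (1 / (2 * δ)))) hVAle
      _ = δ / 2 * (1 / (n : ℝ) * ∑ i, ∫ ω, U i ω ^ 4 ∂P) +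
          1 / (2 * δ) * P.real {ω | L ω ∈ Set.Iic (l / 2)} := by
          simp only [Pi.add_apply]
          rw [integral_add (hUsum.const_mul _) (hAi.const_mul _), integral_const_mul,
            integral_const_mul, integral_const_mul, integral_finsetSum _ fun i _ => hU4i i, hA]
      _ ≤ δ / 2 * (1 / (n : ℝ) * ∑ _i : Fin n, K) + 1 / (2 * δ) * δ ^ 2 := by
          gcongr with i
          exact hU4 i
      _ = (K + 1) / 2 * δ := by
          simp
          field_simp
  -- the loss below the threshold
  have hLα : l * P.real {ω | L ω ∈ Set.Iio α} ≤ 2 * α + l * δ ^ 2 := by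
    by_cases h : α ≤ l / 2
    · have : P.real {ω | L ω ∈ Set.Iio α} ≤ δ ^ 2 :=
        (measureReal_mono fun ω (hω : L ω < α) => hω.le.trans h).trans htail
      have := mul_le_mul_of_nonneg_left this hl.le
      linarith
    · push Not at h
      have := mul_le_mul_of_nonneg_left
        (measureReal_le_one (μ := P) (s := {ω | L ω ∈ Set.Iio α})) hl.le
      nlinarith [mul_pos hl (pow_pos hδpos 2)]
  have hpt (ω) : l * ((if α ≤ L ω then (S ω + b * L ω) / L ω else 0) - b) ^ 2 ≤
      4 / l * S ω ^ 2 + l / α * (V ω * (Set.Iic (l / 2)).indicator 1 (L ω)) +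
        b ^ 2 * (l * (Set.Iio α).indicator 1 (L ω)) :=
    sq_threshold_error_le hl hα (hVnn ω) (sq_mean_mul_le (fun i => U i ω) fun i => x i ω)
  have hi1 := hSmem.integrable_sq.const_mul (4 / l)
  have hi2 := hVAi.const_mul (l / α)
  have hi3 := (hBi.const_mul l).const_mul (b ^ 2)
  have hi12 : Integrable (fun ω => 4 / l * S ω ^ 2 +
      l / α * (V ω * (Set.Iic (l / 2)).indicator 1 (L ω))) P := hi1.add hi2
  have hi : Integrable (fun ω => 4 / l * S ω ^ 2 +
      l / α * (V ω * (Set.Iic (l / 2)).indicator 1 (L ω)) +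
        b ^ 2 * (l * (Set.Iio α).indicator 1 (L ω))) P := hi12.add hi3
  refine (lintegral_mono fun ω => ENNReal.ofReal_le_ofReal (hpt ω)).trans ?_
  rw [← ofReal_integral_eq_lintegral_ofReal hi
    (Eventually.of_forall fun ω => le_trans (mul_nonneg hl.le (sq_nonneg _)) (hpt ω))]
  refine ENNReal.ofReal_le_ofReal ?_
  rw [integral_add hi12 hi3, integral_add hi1 hi2, integral_const_mul,
    integral_const_mul, integral_const_mul, integral_const_mul, hB, hδ2]
  have e : 2 * (K + M) / n = 4 / l * (l * (K + M) / (2 * n)) := by field_simp; ring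
  rw [e]
  gcongr

end Coordinate

/-! ### Moments of the regressor and the error -/

instance secondCountableTopology_L2 : SecondCountableTopology L2 :=
  have : Fact ((2 : ℝ≥0∞) ≠ ⊤) := ⟨ENNReal.ofNat_ne_top⟩
  inferInstance

theorem integrable_pow_four {Ω : Type*} [MeasurableSpace Ω] {P : Measure Ω}
    [IsFiniteMeasure P] {Z : Ω → ℝ} (hZ : MemLp Z 4 P) : Integrable (fun ω => Z ω ^ 4) P := by
  simpa [Even.pow_abs (show Even 4 by decide)] using
    hZ.integrable_norm_pow (p := 4) (by norm_num)

section Moments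

variable {Ω : Type*} [MeasurableSpace Ω] {P : Measure Ω}

theorem memLp_four_of_moment [IsProbabilityMeasure P] {Z : Ω → ℝ} (hZ : AEMeasurable Z P) {q : ℕ} (hq : 4 ≤ q) {η : ℝ}
    (hη : 0 ≤ η) (h : ∫⁻ ω, ENNReal.ofReal (|Z ω| ^ q) ∂P ≤ ENNReal.ofReal η) :
    MemLp Z 4 P ∧ ∫ ω, Z ω ^ 4 ∂P ≤ 1 + η := by
  have hpt (ω) : Z ω ^ 4 ≤ 1 + |Z ω| ^ q := by
    rw [← Even.pow_abs (show Even 4 by decide)]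
    rcases le_total (|Z ω|) 1 with h1 | h1
    · have := pow_le_one₀ (n := 4) (abs_nonneg (Z ω)) h1
      have := pow_nonneg (abs_nonneg (Z ω)) q
      linarith
    · have := pow_le_pow_right₀ h1 hq
      linarith
  have hle : ∫⁻ ω, ENNReal.ofReal (Z ω ^ 4) ∂P ≤ ENNReal.ofReal (1 + η) := by
    calc ∫⁻ ω, ENNReal.ofReal (Z ω ^ 4) ∂P
        ≤ ∫⁻ ω, (1 + ENNReal.ofReal (|Z ω| ^ q)) ∂P := by
          refine lintegral_mono fun ω => (ENNReal.ofReal_le_ofReal (hpt ω)).trans_eq ?_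
          rw [ENNReal.ofReal_add zero_le_one (by positivity), ENNReal.ofReal_one]
      _ = 1 + ∫⁻ ω, ENNReal.ofReal (|Z ω| ^ q) ∂P := by
          rw [lintegral_add_left measurable_const]; simp
      _ ≤ ENNReal.ofReal (1 + η) := by
          rw [ENNReal.ofReal_add zero_le_one hη, ENNReal.ofReal_one]
          gcongr
  have hi : Integrable (fun ω => Z ω ^ 4) P := by
    refine ⟨(hZ.pow_const 4).aestronglyMeasurable, ?_⟩
    rw [hasFiniteIntegral_iff_ofReal (Eventually.of_forall fun ω => by positivity)]
    exact hle.trans_lt ENNReal.ofReal_lt_top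
  refine ⟨?_, ?_⟩
  · have := (integrable_norm_rpow_iff (p := 4) hZ.aestronglyMeasurable (by norm_num)
      (by norm_num)).1 (by
        refine hi.congr (Eventually.of_forall fun ω => ?_)
        simp only [Real.norm_eq_abs, ENNReal.toReal_ofNat]
        rw [show (4 : ℝ) = (4 : ℕ) by norm_num, Real.rpow_natCast,
          Even.pow_abs (show Even 4 by decide)])
    exact this
  · rw [integral_eq_lintegral_of_nonneg_ae (Eventually.of_forall fun ω => by positivity)
      hi.aestronglyMeasurable]
    exact ENNReal.toReal_le_of_le_ofReal (by linarith) hle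

variable {X : Ω → L2} {lam : ℕ → ℝ} {q : ℕ} {η : ℝ}

theorem inner_psi_psi {i j : ℕ} (hi : 1 ≤ i) (hj : 1 ≤ j) :
    (inner ℝ (psi i) (psi j) : ℝ) = if i = j then 1 else 0 := by
  obtain ⟨i, rfl⟩ := Nat.exists_eq_add_of_le' hi
  obtain ⟨j, rfl⟩ := Nat.exists_eq_add_of_le' hj
  simpa using orthonormal_iff_ite.1 orthonormal_psi i j

theorem norm_psi {j : ℕ} (hj : 1 ≤ j) : ‖psi j‖ = 1 := by
  obtain ⟨j, rfl⟩ := Nat.exists_eq_add_of_le' hj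
  exact orthonormal_psi.1 j

namespace IsRegressor

theorem inner_covOp (hX : IsRegressor P X lam q η) (f g : L2) :
    inner ℝ (covOp P X f) g = ∫ ω, inner ℝ f (X ω) * inner ℝ g (X ω) ∂P := by
  have hm := hX.measurable.aemeasurable (μ := P)
  rw [covOp, covarianceOperator_inner ((memLp_map_measure_iff aestronglyMeasurable_id hm).2
    hX.memLp), integral_map hm]
  exact (by fun_prop : Measurable fun z : L2 =>
    (inner ℝ f z * inner ℝ g z : ℝ)).aestronglyMeasurable

theorem lam_pos (hX : IsRegressor P X lam q η) {j : ℕ} (hj : 1 ≤ j) : 0 < lam j := by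
  have h := hX.strictlyPositive (psi j) (norm_ne_zero_iff.1 (by simp [norm_psi hj]))
  rwa [hX.eigen j hj, real_inner_smul_left, inner_psi_psi hj hj, if_pos rfl, mul_one] at h

theorem integral_inner_mul_inner_psi (hX : IsRegressor P X lam q η) (f : L2) {j : ℕ}
    (hj : 1 ≤ j) :
    ∫ ω, inner ℝ f (X ω) * inner ℝ (X ω) (psi j) ∂P = lam j * inner ℝ f (psi j) := by
  have h := hX.inner_covOp (psi j) f
  rw [hX.eigen j hj, real_inner_smul_left, real_inner_comm] at h
  rw [h]
  refine integral_congr_ae (Eventually.of_forall fun ω => ?_)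
  simp only [real_inner_comm (psi j)]
  ring

/-- The operator `T` is diagonal in the trigonometric basis. -/
theorem hasSum_inner_covOp_self (hX : IsRegressor P X lam q η) (f : L2) :
    HasSum (fun j : ℕ => lam (j + 1) * (inner ℝ f (psi (j + 1)) : ℝ) ^ 2)
      (inner ℝ (covOp P X f) f) := by
  have h := trigBasis.hasSum_inner_mul_inner (covOp P X f) f
  simp only [trigBasis_apply] at h
  refine h.congr_fun fun j => ?_
  have h1 : (inner ℝ (covOp P X f) (psi (j + 1)) : ℝ) =
      lam (j + 1) * inner ℝ f (psi (j + 1)) := by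
    rw [← hX.integral_inner_mul_inner_psi f (by omega), hX.inner_covOp]
    simp only [real_inner_comm (psi (j + 1))]
  rw [h1, real_inner_comm f]
  ring

theorem integral_inner_psi_sq (hX : IsRegressor P X lam q η) {j : ℕ} (hj : 1 ≤ j) :
    ∫ ω, (inner ℝ (X ω) (psi j) : ℝ) ^ 2 ∂P = lam j := by
  have h := hX.integral_inner_mul_inner_psi (psi j) hj
  rw [inner_psi_psi hj hj, if_pos rfl, mul_one] at h
  rw [← h]
  refine integral_congr_ae (Eventually.of_forall fun ω => ?_)
  simp only [real_inner_comm (X ω)]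
  ring

variable [IsProbabilityMeasure P]

theorem memLp_four_inner_psi (hX : IsRegressor P X lam q η) (hq : 4 ≤ q) (hη : 0 ≤ η) {j : ℕ}
    (hj : 1 ≤ j) :
    MemLp (fun ω => (inner ℝ (X ω) (psi j) : ℝ)) 4 P ∧
      ∫ ω, (inner ℝ (X ω) (psi j) : ℝ) ^ 4 ∂P ≤ (1 + η) * lam j ^ 2 := by
  have hpos := Real.sqrt_pos.2 (hX.lam_pos hj)
  have hXm := hX.measurable
  obtain ⟨h1, h2⟩ := memLp_four_of_moment (P := P)
    (Z := fun ω => inner ℝ (X ω) (psi j) / √(lam j)) (by fun_prop) hq hη (hX.moment j hj)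
  have e (ω) : (inner ℝ (X ω) (psi j) : ℝ) = √(lam j) * (inner ℝ (X ω) (psi j) / √(lam j)) := by
    field_simp
  refine ⟨(h1.const_mul (√(lam j))).congr_norm (by fun_prop)
    (Eventually.of_forall fun ω => by rw [← e]), ?_⟩
  have e4 : √(lam j) ^ 4 = lam j ^ 2 := by
    rw [show 4 = 2 * 2 by norm_num, pow_mul, Real.sq_sqrt (hX.lam_pos hj).le]
  calc ∫ ω, (inner ℝ (X ω) (psi j) : ℝ) ^ 4 ∂P
      = ∫ ω, lam j ^ 2 * (inner ℝ (X ω) (psi j) / √(lam j)) ^ 4 ∂P := by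
        refine integral_congr_ae (Eventually.of_forall fun ω => ?_)
        simp only
        rw [← e4, ← mul_pow, ← e]
    _ = lam j ^ 2 * ∫ ω, (inner ℝ (X ω) (psi j) / √(lam j)) ^ 4 ∂P := integral_const_mul _ _
    _ ≤ (1 + η) * lam j ^ 2 := by
        rw [mul_comm]
        gcongr

theorem lintegral_sq_mul_sq_le (hX : IsRegressor P X lam q η) (hq : 4 ≤ q) (hη : 0 ≤ η)
    {i j : ℕ} (hi : 1 ≤ i) (hj : 1 ≤ j) :
    ∫⁻ ω, ENNReal.ofReal ((inner ℝ (X ω) (psi i) : ℝ) ^ 2) *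
        ENNReal.ofReal ((inner ℝ (X ω) (psi j) : ℝ) ^ 2) ∂P ≤
      ENNReal.ofReal (1 + η) * (ENNReal.ofReal (lam i) * ENNReal.ofReal (lam j)) := by
  have hli := hX.lam_pos hi
  have hlj := hX.lam_pos hj
  obtain ⟨hi4, hi4'⟩ := hX.memLp_four_inner_psi hq hη hi
  obtain ⟨hj4, hj4'⟩ := hX.memLp_four_inner_psi hq hη hj
  have hii := (integrable_pow_four hi4).const_mul (lam j / lam i / 2)
  have hij := (integrable_pow_four hj4).const_mul (1 / (2 * (lam j / lam i)))
  have hsum : Integrable (fun ω => lam j / lam i / 2 * (inner ℝ (X ω) (psi i) : ℝ) ^ 4 +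
      1 / (2 * (lam j / lam i)) * (inner ℝ (X ω) (psi j) : ℝ) ^ 4) P := hii.add hij
  calc _ ≤ ∫⁻ ω, ENNReal.ofReal (lam j / lam i / 2 * (inner ℝ (X ω) (psi i) : ℝ) ^ 4 +
        1 / (2 * (lam j / lam i)) * (inner ℝ (X ω) (psi j) : ℝ) ^ 4) ∂P := by
        refine lintegral_mono fun ω => ?_
        rw [← ENNReal.ofReal_mul (sq_nonneg _), ← mul_pow]
        exact ENNReal.ofReal_le_ofReal (sq_mul_sq_le (by positivity))
    _ = ENNReal.ofReal (∫ ω, (lam j / lam i / 2 * (inner ℝ (X ω) (psi i) : ℝ) ^ 4 +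
        1 / (2 * (lam j / lam i)) * (inner ℝ (X ω) (psi j) : ℝ) ^ 4) ∂P) :=
        (ofReal_integral_eq_lintegral_ofReal hsum
          (Eventually.of_forall fun ω => by positivity)).symm
    _ ≤ ENNReal.ofReal ((1 + η) * (lam i * lam j)) := by
        refine ENNReal.ofReal_le_ofReal ?_
        rw [integral_add hii hij, integral_const_mul, integral_const_mul]
        calc _ ≤ lam j / lam i / 2 * ((1 + η) * lam i ^ 2) +
              1 / (2 * (lam j / lam i)) * ((1 + η) * lam j ^ 2) := by gcongr
          _ = (1 + η) * (lam i * lam j) := by field_simp; ring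
    _ = _ := by
        rw [ENNReal.ofReal_mul (by linarith), ENNReal.ofReal_mul hli.le]

/-- The fourth moment of the norm is controlled by the trace of `T`. -/
theorem memLp_four (hX : IsRegressor P X lam q η) (hq : 4 ≤ q) (hη : 0 ≤ η) {Λ : ℝ}
    (hΛ0 : 0 ≤ Λ) (hΛ : ∑' j : ℕ, ENNReal.ofReal (lam (j + 1)) ≤ ENNReal.ofReal Λ) :
    MemLp X 4 P ∧ ∫ ω, ‖X ω‖ ^ 4 ∂P ≤ (1 + η) * Λ ^ 2 := by
  have hXm := hX.measurable
  have hpt (ω) : ENNReal.ofReal (‖X ω‖ ^ 4) =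
      ∑' i : ℕ, ∑' j : ℕ, ENNReal.ofReal ((inner ℝ (X ω) (psi (i + 1)) : ℝ) ^ 2) *
        ENNReal.ofReal ((inner ℝ (X ω) (psi (j + 1)) : ℝ) ^ 2) := by
    have h := hasSum_sq_inner_psi (X ω)
    have e : ENNReal.ofReal (‖X ω‖ ^ 2) =
        ∑' i : ℕ, ENNReal.ofReal ((inner ℝ (X ω) (psi (i + 1)) : ℝ) ^ 2) := by
      rw [← h.tsum_eq, ENNReal.ofReal_tsum_of_nonneg (fun _ => sq_nonneg _) h.summable]
    simp_rw [ENNReal.tsum_mul_left, ENNReal.tsum_mul_right]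
    rw [← e, ← ENNReal.ofReal_mul (sq_nonneg _)]
    congr 1
    ring
  have hle : ∫⁻ ω, ENNReal.ofReal (‖X ω‖ ^ 4) ∂P ≤ ENNReal.ofReal ((1 + η) * Λ ^ 2) := by
    simp_rw [hpt]
    rw [lintegral_tsum fun i => by fun_prop]
    calc _ ≤ ∑' i : ℕ, ∑' j : ℕ, ENNReal.ofReal (1 + η) *
          (ENNReal.ofReal (lam (i + 1)) * ENNReal.ofReal (lam (j + 1))) := by
          refine ENNReal.tsum_le_tsum fun i => ?_
          rw [lintegral_tsum fun j => by fun_prop]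
          exact ENNReal.tsum_le_tsum fun j =>
            hX.lintegral_sq_mul_sq_le hq hη (by omega) (by omega)
      _ ≤ ENNReal.ofReal (1 + η) * (ENNReal.ofReal Λ * ENNReal.ofReal Λ) := by
          simp_rw [ENNReal.tsum_mul_left, ENNReal.tsum_mul_right]
          gcongr
      _ = _ := by
          rw [← ENNReal.ofReal_mul hΛ0, ← ENNReal.ofReal_mul (by linarith), pow_two]
  have hi : Integrable (fun ω => ‖X ω‖ ^ 4) P := by
    refine ⟨(by fun_prop : AEMeasurable (fun ω => ‖X ω‖ ^ 4) P).aestronglyMeasurable, ?_⟩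
    rw [hasFiniteIntegral_iff_ofReal (Eventually.of_forall fun ω => by positivity)]
    exact hle.trans_lt ENNReal.ofReal_lt_top
  refine ⟨?_, ?_⟩
  · refine (integrable_norm_rpow_iff (p := 4) hX.memLp.aestronglyMeasurable (by norm_num)
      (by norm_num)).1 (hi.congr (Eventually.of_forall fun ω => ?_))
    simp only [ENNReal.toReal_ofNat]
    rw [show (4 : ℝ) = (4 : ℕ) by norm_num, Real.rpow_natCast]
  · rw [integral_eq_lintegral_of_nonneg_ae (Eventually.of_forall fun ω => by positivity)
      hi.aestronglyMeasurable]
    exact ENNReal.toReal_le_of_le_ofReal (by positivity) hle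

end IsRegressor

variable [IsProbabilityMeasure P]

/-! ### The effective noise in a coordinate -/

/-- The effective noise in the equation for the coordinate `⟨β, ψ_j⟩`: the contribution of all
other coordinates of the slope, plus the error. -/
noncomputable def coordNoise (β : L2) (σ : ℝ) (j : ℕ) (x : L2) (e : ℝ) : ℝ :=
  inner ℝ β x - inner ℝ β (psi j) * inner ℝ x (psi j) + σ * e

theorem measurable_coordNoise (β : L2) (σ : ℝ) (j : ℕ) :
    Measurable fun z : L2 × ℝ => coordNoise β σ j z.1 z.2 := by
  unfold coordNoise
  fun_prop

/-- A bound for the fourth moment of the effective noise in any coordinate. -/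
noncomputable def noiseMoment (ρ σ η Λ : ℝ) : ℝ :=
  8 * (16 * ρ ^ 2 * ((1 + η) * Λ ^ 2) + σ ^ 4 * (1 + η))

theorem noiseMoment_nonneg {ρ σ η Λ : ℝ} (hη : 0 ≤ η) : 0 ≤ noiseMoment ρ σ η Λ := by
  unfold noiseMoment
  positivity

theorem add_pow_four_le (a b : ℝ) : (a + b) ^ 4 ≤ 8 * (a ^ 4 + b ^ 4) := by
  have h1 : (a + b) ^ 2 ≤ 2 * (a ^ 2 + b ^ 2) := by nlinarith [sq_nonneg (a - b)]
  have h2 : (2 * (a ^ 2 + b ^ 2)) ^ 2 ≤ 8 * (a ^ 4 + b ^ 4) := by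
    nlinarith [sq_nonneg (a ^ 2 - b ^ 2)]
  calc (a + b) ^ 4 = ((a + b) ^ 2) ^ 2 := by ring
    _ ≤ (2 * (a ^ 2 + b ^ 2)) ^ 2 := by gcongr
    _ ≤ _ := h2

theorem coordNoise_pow_four_le {β : L2} {ρ : ℝ} (hβ : ‖β‖ ^ 2 ≤ ρ) (σ : ℝ) {j : ℕ} (hj : 1 ≤ j)
    (x : L2) (e : ℝ) :
    coordNoise β σ j x e ^ 4 ≤ 8 * (16 * ρ ^ 2 * ‖x‖ ^ 4 + σ ^ 4 * e ^ 4) := by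
  have h1 : |inner ℝ β x - inner ℝ β (psi j) * inner ℝ x (psi j)| ≤ 2 * (‖β‖ * ‖x‖) := by
    have a1 := abs_real_inner_le_norm β x
    have a2 := abs_real_inner_le_norm β (psi j)
    have a3 := abs_real_inner_le_norm x (psi j)
    rw [norm_psi hj, mul_one] at a2 a3
    have a4 := abs_sub (inner ℝ β x : ℝ) (inner ℝ β (psi j) * inner ℝ x (psi j))
    rw [abs_mul] at a4
    have := mul_le_mul a2 a3 (abs_nonneg _) (norm_nonneg _)
    linarith
  have h2 : (inner ℝ β x - inner ℝ β (psi j) * inner ℝ x (psi j) : ℝ) ^ 4 ≤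
      16 * ρ ^ 2 * ‖x‖ ^ 4 := by
    rw [← Even.pow_abs (show Even 4 by decide)]
    calc _ ≤ (2 * (‖β‖ * ‖x‖)) ^ 4 := by gcongr
      _ = 16 * (‖β‖ ^ 2) ^ 2 * ‖x‖ ^ 4 := by ring
      _ ≤ _ := by gcongr
  calc _ ≤ _ := add_pow_four_le _ _
    _ ≤ _ := by
        rw [mul_pow]
        gcongr

theorem memLp_four_coordNoise {ε : Ω → ℝ} (hX : IsRegressor P X lam q η) (hε : IsError P ε q η)
    (hq : 4 ≤ q) (hη : 0 ≤ η) {Λ : ℝ} (hΛ0 : 0 ≤ Λ)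
    (hΛ : ∑' j : ℕ, ENNReal.ofReal (lam (j + 1)) ≤ ENNReal.ofReal Λ)
    {β : L2} {ρ : ℝ} (hβ : ‖β‖ ^ 2 ≤ ρ) (σ : ℝ) {j : ℕ} (hj : 1 ≤ j) :
    MemLp (fun ω => coordNoise β σ j (X ω) (ε ω)) 4 P ∧
      ∫ ω, coordNoise β σ j (X ω) (ε ω) ^ 4 ∂P ≤ noiseMoment ρ σ η Λ := by
  obtain ⟨hX4, hX4'⟩ := hX.memLp_four hq hη hΛ0 hΛ
  obtain ⟨hε4, hε4'⟩ := memLp_four_of_moment hε.measurable.aemeasurable hq hη hε.moment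
  have h1 : MemLp (fun ω => (inner ℝ β (X ω) : ℝ)) 4 P := hX4.const_inner β
  have h2 : MemLp (fun ω => (inner ℝ β (psi j) : ℝ) * (inner ℝ (X ω) (psi j) : ℝ)) 4 P :=
    (hX4.inner_const (psi j)).const_mul _
  have hmem : MemLp (fun ω => coordNoise β σ j (X ω) (ε ω)) 4 P :=
    (h1.sub h2).add (hε4.const_mul σ)
  refine ⟨hmem, ?_⟩
  have hi1 : Integrable (fun ω => 16 * ρ ^ 2 * ‖X ω‖ ^ 4) P :=
    (integrable_pow_four hX4.norm).const_mul _
  have hi2 : Integrable (fun ω => σ ^ 4 * ε ω ^ 4) P := (integrable_pow_four hε4).const_mul _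
  calc _ ≤ ∫ ω, 8 * (16 * ρ ^ 2 * ‖X ω‖ ^ 4 + σ ^ 4 * ε ω ^ 4) ∂P :=
        integral_mono (integrable_pow_four hmem) ((hi1.add hi2).const_mul 8)
          fun ω => coordNoise_pow_four_le hβ σ hj _ _
    _ = 8 * (16 * ρ ^ 2 * ∫ ω, ‖X ω‖ ^ 4 ∂P + σ ^ 4 * ∫ ω, ε ω ^ 4 ∂P) := by
        rw [integral_const_mul, integral_add hi1 hi2, integral_const_mul, integral_const_mul]
    _ ≤ _ := by
        unfold noiseMoment
        gcongr

/-- The effective noise is uncorrelated with the regressor in the same coordinate: the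
coordinates of `X` are uncorrelated, and so are `X` and `ε`. -/
theorem integral_coordNoise_mul {ε : Ω → ℝ} (hX : IsRegressor P X lam q η)
    (hε : IsError P ε q η) (hun : Uncorrelated P X ε) (β : L2) (σ : ℝ) {j : ℕ} (hj : 1 ≤ j) :
    ∫ ω, coordNoise β σ j (X ω) (ε ω) * inner ℝ (X ω) (psi j) ∂P = 0 := by
  have hβ2 : MemLp (fun ω => (inner ℝ β (X ω) : ℝ)) 2 P := hX.memLp.const_inner β
  have hψ2 : MemLp (fun ω => (inner ℝ (X ω) (psi j) : ℝ)) 2 P := hX.memLp.inner_const (psi j)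
  have hcov : ∫ ω, inner ℝ (X ω) (psi j) * ε ω ∂P = 0 := by
    have h := hun (psi j)
    rw [covariance_eq_sub hψ2 hε.memLp, hε.centered, mul_zero, sub_zero] at h
    simpa using h
  have i1 : Integrable (fun ω => (inner ℝ β (X ω) * inner ℝ (X ω) (psi j) : ℝ)) P :=
    hβ2.integrable_mul hψ2
  have i2 : Integrable (fun ω => inner ℝ β (psi j) * (inner ℝ (X ω) (psi j) : ℝ) ^ 2) P :=
    hψ2.integrable_sq.const_mul _
  have i3 : Integrable (fun ω => σ * ((inner ℝ (X ω) (psi j) : ℝ) * ε ω)) P :=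
    (hψ2.integrable_mul hε.memLp).const_mul σ
  have i12 : Integrable (fun ω => (inner ℝ β (X ω) * inner ℝ (X ω) (psi j) : ℝ) -
      inner ℝ β (psi j) * (inner ℝ (X ω) (psi j) : ℝ) ^ 2) P := i1.sub i2
  calc _ = ∫ ω, ((inner ℝ β (X ω) * inner ℝ (X ω) (psi j) : ℝ) -
        inner ℝ β (psi j) * (inner ℝ (X ω) (psi j) : ℝ) ^ 2 +
          σ * ((inner ℝ (X ω) (psi j) : ℝ) * ε ω)) ∂P := by
        refine integral_congr_ae (Eventually.of_forall fun ω => ?_)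
        simp only [coordNoise]
        ring
    _ = 0 := by
        rw [integral_add i12 i3, integral_sub i1 i2, integral_const_mul, integral_const_mul,
          hcov, hX.integral_inner_mul_inner_psi β hj, hX.integral_inner_psi_sq hj]
        ring

end Moments

/-! ### A bound for the mean prediction error -/

theorem inner_betaHat_psi (m : ℕ) (α : ℝ) {n : ℕ} (Y : Fin n → ℝ) (X : Fin n → L2) (j : ℕ) :
    (inner ℝ (betaHat m α Y X) (psi (j + 1)) : ℝ) =
      if j < m then
        if α ≤ lamHat X (j + 1) then gHat Y X (j + 1) / lamHat X (j + 1) else 0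
      else 0 := by
  rw [betaHat, sum_inner]
  have h : ∀ i ∈ Finset.Icc 1 m,
      (inner ℝ ((if α ≤ lamHat X i then gHat Y X i / lamHat X i else 0) • psi i)
        (psi (j + 1)) : ℝ) =
      if j + 1 = i then (if α ≤ lamHat X i then gHat Y X i / lamHat X i else 0) else 0 := by
    intro i hi
    rw [real_inner_smul_left, inner_psi_psi (Finset.mem_Icc.1 hi).1 (by omega)]
    simp [eq_comm]
  have hmem : j + 1 ∈ Finset.Icc 1 m ↔ j < m := by
    rw [Finset.mem_Icc]
    omega
  rw [Finset.sum_congr rfl h, Finset.sum_ite_eq]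
  simp only [hmem]

/-- The numerator `ĝ_j` is `⟨β, ψ_j⟩ λ̂_j` plus an average of noise terms. -/
theorem gHat_response (β : L2) (σ : ℝ) {n : ℕ} (X : Fin n → L2) (e : Fin n → ℝ) (j : ℕ) :
    gHat (fun i => response β σ (X i) (e i)) X j =
      1 / (n : ℝ) * ∑ i, coordNoise β σ j (X i) (e i) * inner ℝ (X i) (psi j) +
        inner ℝ β (psi j) * (1 / (n : ℝ) * ∑ i, (inner ℝ (X i) (psi j) : ℝ) ^ 2) := by
  rw [gHat, mul_left_comm, ← mul_add, Finset.mul_sum _ _ (inner ℝ β (psi j)),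
    ← Finset.sum_add_distrib]
  congr 1
  refine Finset.sum_congr rfl fun i _ => ?_
  rw [response, coordNoise]
  ring

/-- The factor of `1 / n` in the risk of a single coordinate. -/
noncomputable def varianceConst (ρ σ η Λ c : ℝ) : ℝ :=
  2 * (noiseMoment ρ σ η Λ + (1 + η)) +
    Λ / c * ((noiseMoment ρ σ η Λ + 1) / 2 * (512 * (1 + η) ^ 2))

/-- The factor of `⟨β, ψ_j⟩² / n` in the risk of a single coordinate. -/
noncomputable def thresholdConst (η Λ c : ℝ) : ℝ := 2 * c + Λ * (8 * (1 + η))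

theorem exp_neg_le_inv_sq {y : ℝ} (hy : 0 < y) : Real.exp (-y) ≤ 2 / y ^ 2 := by
  have h := Real.quadratic_le_exp_of_nonneg hy.le
  rw [Real.exp_neg, inv_le_comm₀ (Real.exp_pos y) (by positivity), inv_div]
  linarith

theorem exp_neg_le_inv {y : ℝ} (hy : 0 < y) : Real.exp (-y) ≤ 1 / y := by
  have h := Real.add_one_le_exp y
  rw [Real.exp_neg, inv_le_comm₀ (Real.exp_pos y) (by positivity), one_div, inv_inv]
  linarith

section Risk

variable {Ω : Type*} [MeasurableSpace Ω] {P : Measure Ω} [IsProbabilityMeasure P]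
  {X : Ω → L2} {ε : Ω → ℝ} {n : ℕ} {Xs : Fin n → Ω → L2} {εs : Fin n → Ω → ℝ}
  {lam : ℕ → ℝ} {q : ℕ} {η Λ ρ α c₁ c₂ : ℝ} {β : L2}

theorem lintegral_coord_le (hX : IsRegressor P X lam q η) (hε : IsError P ε q η)
    (hun : Uncorrelated P X ε) (hs : IsSample P X ε Xs εs) (hq : 4 ≤ q) (hη : 0 ≤ η)
    (hn : 0 < n) (hΛ : ∑' j : ℕ, ENNReal.ofReal (lam (j + 1)) ≤ ENNReal.ofReal Λ)
    (hΛ0 : 0 ≤ Λ) (hβ : ‖β‖ ^ 2 ≤ ρ) (σ : ℝ) (hc₁ : 0 < c₁) (hα₁ : c₁ / n ≤ α)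
    (hα₂ : α ≤ c₂ / n) {m j : ℕ} (hj : j < m) :
    ∫⁻ ω, ENNReal.ofReal (lam (j + 1) * (inner ℝ
        (betaHat m α (fun i => response β σ (Xs i ω) (εs i ω)) (fun i => Xs i ω) - β)
        (psi (j + 1)) : ℝ) ^ 2) ∂P ≤
      ENNReal.ofReal (varianceConst ρ σ η Λ c₁ / n +
        thresholdConst η Λ c₂ / n * (inner ℝ β (psi (j + 1)) : ℝ) ^ 2) := by
  have hn' : (0 : ℝ) < n := by exact_mod_cast hn
  have hj1 : 1 ≤ j + 1 := by omega
  have hl := hX.lam_pos hj1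
  have hlΛ : lam (j + 1) ≤ Λ :=
    (ENNReal.ofReal_le_ofReal_iff hΛ0).1 ((ENNReal.le_tsum j).trans hΛ)
  have hα : 0 < α := lt_of_lt_of_le (by positivity) hα₁
  have hK := noiseMoment_nonneg (ρ := ρ) (σ := σ) (Λ := Λ) hη
  obtain ⟨hx4, hx4'⟩ := hX.memLp_four_inner_psi hq hη hj1
  obtain ⟨hU4, hU4'⟩ := memLp_four_coordNoise hX hε hq hη hΛ0 hΛ hβ σ hj1
  have hmx : Measurable fun z : L2 × ℝ => (inner ℝ z.1 (psi (j + 1)) : ℝ) := by fun_prop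
  have hmU := measurable_coordNoise β σ (j + 1)
  have idx (i) := (hs.identDistrib i).comp hmx
  have idU (i) := (hs.identDistrib i).comp hmU
  have h := lintegral_sq_threshold_error_le (P := P) (b := inner ℝ β (psi (j + 1)))
    (x := fun i ω => inner ℝ (Xs i ω) (psi (j + 1)))
    (U := fun i ω => coordNoise β σ (j + 1) (Xs i ω) (εs i ω))
    (M := 1 + η) (K := noiseMoment ρ σ η Λ) hl (by linarith) hα hn
    (hs.indep.comp (fun _ z => ((inner ℝ z.1 (psi (j + 1)) : ℝ),
      coordNoise β σ (j + 1) z.1 z.2)) fun _ => hmx.prodMk hmU)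
    (fun i => (idx i).memLp_iff.2 hx4) (fun i => (idU i).memLp_iff.2 hU4)
    (fun i => ((hs.identDistrib i).comp (hmU.mul hmx)).integral_eq.trans
      (integral_coordNoise_mul hX hε hun β σ hj1))
    (fun i => ((hs.identDistrib i).comp (hmx.pow_const 2)).integral_eq.trans
      (hX.integral_inner_psi_sq hj1))
    (fun i => ((hs.identDistrib i).comp (hmx.pow_const 4)).integral_eq.trans_le hx4')
    (fun i => ((hs.identDistrib i).comp (hmU.pow_const 4)).integral_eq.trans_le hU4')
  simp_rw [inner_sub_left, inner_betaHat_psi, if_pos hj, gHat_response, lamHat]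
  refine h.trans (ENNReal.ofReal_le_ofReal ?_)
  have h1 : lam (j + 1) / α * ((noiseMoment ρ σ η Λ + 1) / 2 *
      Real.exp (-(n / (16 * (1 + η))))) ≤
      Λ / c₁ * ((noiseMoment ρ σ η Λ + 1) / 2 * (512 * (1 + η) ^ 2)) / n := by
    have he := exp_neg_le_inv_sq (show 0 < n / (16 * (1 + η)) by positivity)
    calc _ ≤ Λ / (c₁ / n) * ((noiseMoment ρ σ η Λ + 1) / 2 *
          (2 / (n / (16 * (1 + η))) ^ 2)) := by gcongr
      _ = _ := by field_simp; ring
  have h2 : 2 * α + lam (j + 1) * Real.exp (-(n / (8 * (1 + η)))) ≤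
      thresholdConst η Λ c₂ / n := by
    have he := exp_neg_le_inv (show 0 < n / (8 * (1 + η)) by positivity)
    calc _ ≤ 2 * (c₂ / n) + Λ * (1 / (n / (8 * (1 + η)))) := by gcongr
      _ = _ := by unfold thresholdConst; field_simp
  have h3 := mul_le_mul_of_nonneg_left h2 (sq_nonneg (inner ℝ β (psi (j + 1)) : ℝ))
  rw [varianceConst, add_div _ _ (n : ℝ)]
  linarith

theorem norm_sq_le_of_mem_ellipsoid {w : ℕ → ℝ} (hw : ∀ j, 1 ≤ w (j + 1)) (hρ : 0 ≤ ρ)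
    (hβ : β ∈ ellipsoid w ρ) : ‖β‖ ^ 2 ≤ ρ := by
  have h := hasSum_sq_inner_psi β
  rw [← ENNReal.ofReal_le_ofReal_iff hρ, ← h.tsum_eq,
    ENNReal.ofReal_tsum_of_nonneg (fun _ => sq_nonneg _) h.summable]
  refine le_trans (ENNReal.tsum_le_tsum fun j => ENNReal.ofReal_le_ofReal ?_) hβ
  exact le_mul_of_one_le_left (sq_nonneg _) (hw j)

/-- The mean prediction error is at most a multiple of `m / n` plus the truncation bias, which is
bounded by `B * ρ` if `λ_j ≤ B * w_j` for all `j > m`. -/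
theorem meanPredictionError_le (hX : IsRegressor P X lam q η) (hε : IsError P ε q η)
    (hun : Uncorrelated P X ε) (hs : IsSample P X ε Xs εs) (hq : 4 ≤ q) (hη : 0 ≤ η)
    (hn : 0 < n) (hΛ : ∑' j : ℕ, ENNReal.ofReal (lam (j + 1)) ≤ ENNReal.ofReal Λ)
    (hΛ0 : 0 ≤ Λ) {w : ℕ → ℝ} (hw : ∀ j, 1 ≤ w (j + 1)) (hρ : 0 ≤ ρ)
    (hβ : β ∈ ellipsoid w ρ) (σ : ℝ) (hc₁ : 0 < c₁) (hc₂ : 0 ≤ c₂) (hα₁ : c₁ / n ≤ α)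
    (hα₂ : α ≤ c₂ / n) {m : ℕ} {B : ℝ} (hB0 : 0 ≤ B)
    (hB : ∀ j, m ≤ j → lam (j + 1) ≤ B * w (j + 1)) :
    meanPredictionError P (covOp P X) m α σ Xs εs β ≤
      ENNReal.ofReal (m * (varianceConst ρ σ η Λ c₁ / n) +
        (thresholdConst η Λ c₂ / n + B) * ρ) := by
  have hn' : (0 : ℝ) < n := by exact_mod_cast hn
  have hK := noiseMoment_nonneg (ρ := ρ) (σ := σ) (Λ := Λ) hη
  have hC₁ : 0 ≤ varianceConst ρ σ η Λ c₁ / n := by unfold varianceConst; positivity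
  have hC₂ : 0 ≤ thresholdConst η Λ c₂ / n := by unfold thresholdConst; positivity
  have hexp (f : L2) : ENNReal.ofReal (inner ℝ (covOp P X f) f) =
      ∑' j : ℕ, ENNReal.ofReal (lam (j + 1) * (inner ℝ f (psi (j + 1)) : ℝ) ^ 2) := by
    have h := hX.hasSum_inner_covOp_self f
    rw [← h.tsum_eq, ENNReal.ofReal_tsum_of_nonneg (fun j => mul_nonneg
      (hX.lam_pos (by omega)).le (sq_nonneg _)) h.summable]
  have hXm (i) : AEMeasurable (Xs i) P := (hs.identDistrib i).aemeasurable_fst.fst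
  have hεm (i) : AEMeasurable (εs i) P := (hs.identDistrib i).aemeasurable_fst.snd
  have hin (i) (f : L2) : AEMeasurable (fun ω => (inner ℝ (Xs i ω) f : ℝ)) P :=
    (by fun_prop : Measurable fun z : L2 => (inner ℝ z f : ℝ)).comp_aemeasurable (hXm i)
  have hlam (j) : AEMeasurable (fun ω => lamHat (fun i => Xs i ω) j) P := by
    unfold lamHat
    fun_prop
  have hg (j) : AEMeasurable (fun ω => gHat (fun i => response β σ (Xs i ω) (εs i ω))
      (fun i => Xs i ω) j) P := by
    simp only [gHat, response, real_inner_comm _ β]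
    fun_prop
  have hratio : Measurable fun z : ℝ × ℝ => if α ≤ z.2 then z.1 / z.2 else 0 :=
    Measurable.ite (measurableSet_le measurable_const measurable_snd) (by fun_prop)
      measurable_const
  unfold meanPredictionError
  simp_rw [hexp]
  rw [lintegral_tsum]
  · calc _ ≤ ∑' j : ℕ, ((if j < m then ENNReal.ofReal (varianceConst ρ σ η Λ c₁ / n) else 0) +
          ENNReal.ofReal (thresholdConst η Λ c₂ / n + B) *
            ENNReal.ofReal (w (j + 1) * (inner ℝ β (psi (j + 1)) : ℝ) ^ 2)) := by
          refine ENNReal.tsum_le_tsum fun j => ?_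
          have hb := sq_nonneg (inner ℝ β (psi (j + 1)) : ℝ)
          have hwj := hw j
          rw [← ENNReal.ofReal_mul (add_nonneg hC₂ hB0)]
          split_ifs with hj
          · rw [← ENNReal.ofReal_add hC₁ (by positivity)]
            refine (lintegral_coord_le hX hε hun hs hq hη hn hΛ hΛ0
              (norm_sq_le_of_mem_ellipsoid hw hρ hβ) σ hc₁ hα₁ hα₂ hj).trans
              (ENNReal.ofReal_le_ofReal ?_)
            gcongr
            · linarith
            · exact le_mul_of_one_le_left hb hwj
          · simp_rw [inner_sub_left, inner_betaHat_psi, if_neg hj]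
            simp only [zero_sub, neg_sq, lintegral_const, measure_univ, mul_one, zero_add]
            refine ENNReal.ofReal_le_ofReal ?_
            calc _ ≤ B * w (j + 1) * (inner ℝ β (psi (j + 1)) : ℝ) ^ 2 := by
                  gcongr
                  exact hB j (not_lt.1 hj)
              _ ≤ _ := by
                  rw [mul_assoc]
                  gcongr
                  linarith
      _ = m * ENNReal.ofReal (varianceConst ρ σ η Λ c₁ / n) +
          ENNReal.ofReal (thresholdConst η Λ c₂ / n + B) * weightedNormSq w β := by
          rw [ENNReal.tsum_add, ENNReal.tsum_mul_left, weightedNormSq]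
          congr 1
          rw [tsum_eq_sum (s := Finset.range m) fun j hj => if_neg (by simpa using hj),
            Finset.sum_congr rfl fun j hj => if_pos (Finset.mem_range.1 hj)]
          simp
      _ ≤ m * ENNReal.ofReal (varianceConst ρ σ η Λ c₁ / n) +
          ENNReal.ofReal (thresholdConst η Λ c₂ / n + B) * ENNReal.ofReal ρ := by
          gcongr
          exact hβ
      _ = _ := by
          rw [← ENNReal.ofReal_natCast m, ← ENNReal.ofReal_mul (by positivity),
            ← ENNReal.ofReal_mul (by positivity),
            ← ENNReal.ofReal_add (by positivity) (by positivity)]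
  · intro j
    simp_rw [inner_sub_left, inner_betaHat_psi]
    have : AEMeasurable (fun ω => if α ≤ lamHat (fun i => Xs i ω) (j + 1) then
        gHat (fun i => response β σ (Xs i ω) (εs i ω)) (fun i => Xs i ω) (j + 1) /
          lamHat (fun i => Xs i ω) (j + 1) else 0) P :=
      hratio.comp_aemeasurable ((hg (j + 1)).prodMk (hlam (j + 1)))
    split_ifs <;> fun_prop

end Risk

/-! ### Rates -/

theorem one_le_sobolevWeight {p : ℝ} (hp : 0 ≤ p) (j : ℕ) : 1 ≤ sobolevWeight p j := by
  unfold sobolevWeight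
  split_ifs with h
  · rfl
  · have : 1 ≤ j / 2 := by omega
    exact Real.one_le_rpow (by exact_mod_cast this) (by positivity)

theorem sobolevWeight_mono {p : ℝ} (hp : 0 ≤ p) : Monotone (sobolevWeight p) := by
  intro i j hij
  by_cases hi : i ≤ 1
  · rw [sobolevWeight, if_pos hi]
    exact one_le_sobolevWeight hp j
  · rw [sobolevWeight, sobolevWeight, if_neg hi, if_neg (by omega)]
    have : i / 2 ≤ j / 2 := Nat.div_le_div_right hij
    exact Real.rpow_le_rpow (by positivity) (by exact_mod_cast this) (by positivity)

/-- Decreasing summable weights turn the risk bound into the rate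
`(m + 1) / n + υ_{m+1} / w_{m+1}`. -/
theorem attainsRate_of_bounds {p ρ σ d η : ℝ} {q : ℕ} (hp : 0 ≤ p) (hρ : 0 < ρ)
    (hd : 1 ≤ d) (hη : 1 ≤ η) (hq : 4 ≤ q) {m : ℕ → ℕ} {α : ℕ → ℝ}
    (hα : SameOrder α (fun n => 1 / (n : ℝ))) {υ : ℕ → ℝ} (hυ0 : ∀ j, 0 < υ j)
    (hυ : ∀ i j, 1 ≤ i → i ≤ j → υ j ≤ υ i) (hsum : Summable υ) {rate : ℕ → ℝ}
    (hvar : Lesssim (fun n => ((m n : ℝ) + 1) / n) rate)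
    (hbias : Lesssim (fun n => υ (m n + 1) / sobolevWeight p (m n + 1)) rate) :
    AttainsRate.{u} p ρ σ d η q υ m α rate := by
  obtain ⟨⟨c₂, hc₂, hα₂⟩, ⟨c, hc, hα₁⟩⟩ := hα
  obtain ⟨C₁, hC₁, hvar⟩ := hvar
  obtain ⟨C₂, hC₂, hbias⟩ := hbias
  set Λ := d * ∑' j, υ (j + 1) with hΛdef
  have hsum1 : Summable fun j => υ (j + 1) := (summable_nat_add_iff 1).2 hsum
  have hΛ0 : 0 ≤ Λ := mul_nonneg (by linarith) (tsum_nonneg fun j => (hυ0 _).le)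
  have hK := noiseMoment_nonneg (ρ := ρ) (σ := σ) (Λ := Λ) (show 0 ≤ η by linarith)
  have hA₁ : 0 ≤ varianceConst ρ σ η Λ (1 / c) := by unfold varianceConst; positivity
  have hA₂ : 0 ≤ thresholdConst η Λ c₂ := by unfold thresholdConst; positivity
  obtain ⟨N, hN⟩ := eventually_atTop.1
    (((hα₁.and hα₂).and (hvar.and hbias)).and (eventually_gt_atTop 0))
  refine ⟨(varianceConst ρ σ η Λ (1 / c) + thresholdConst η Λ c₂ * ρ) * C₁ + d * ρ * C₂,
    by positivity, N, fun n hn Ω _ P _ X ε Xs εs lam hX hlink hε hun hs => ?_⟩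
  obtain ⟨⟨⟨h1, h2⟩, h3, h4⟩, hn0⟩ := hN n hn
  have hn' : (0 : ℝ) < n := by exact_mod_cast hn0
  have hlam (j : ℕ) : lam (j + 1) ≤ d * υ (j + 1) :=
    (div_le_iff₀ (hυ0 _)).1 (hlink (j + 1) (by omega)).2
  have hΛ : ∑' j : ℕ, ENNReal.ofReal (lam (j + 1)) ≤ ENNReal.ofReal Λ := by
    rw [hΛdef, ← tsum_mul_left, ENNReal.ofReal_tsum_of_nonneg
      (fun j => mul_nonneg (by linarith) (hυ0 _).le) (hsum1.mul_left d)]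
    exact ENNReal.tsum_le_tsum fun j => ENNReal.ofReal_le_ofReal (hlam j)
  have hw1 := one_le_sobolevWeight hp (m n + 1)
  have hB0 : 0 ≤ d * (υ (m n + 1) / sobolevWeight p (m n + 1)) :=
    mul_nonneg (by linarith) (div_nonneg (hυ0 _).le (by linarith))
  refine iSup₂_le fun β hβ => ?_
  refine (meanPredictionError_le (c₁ := 1 / c) (c₂ := c₂) hX hε hun hs hq (by linarith) hn0 hΛ
    hΛ0 (fun j => one_le_sobolevWeight hp (j + 1)) hρ.le hβ σ (by positivity) hc₂.le ?_ ?_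
    hB0 fun j hj => ?_).trans (ENNReal.ofReal_le_ofReal ?_)
  · rw [div_right_comm, div_le_iff₀' hc]
    exact h1
  · simpa [div_eq_mul_inv] using h2
  · calc lam (j + 1) ≤ d * υ (j + 1) := hlam j
      _ ≤ d * υ (m n + 1) := by
          gcongr
          exact hυ _ _ (by omega) (by omega)
      _ = d * (υ (m n + 1) / sobolevWeight p (m n + 1)) * sobolevWeight p (m n + 1) := by
          field_simp
      _ ≤ _ := by
          gcongr
          exact sobolevWeight_mono hp (by omega)
  · have e1 : (m n : ℝ) / n ≤ C₁ * rate n := (div_le_div_of_nonneg_right (by linarith) hn'.le).trans h3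
    have e2 : 1 / (n : ℝ) ≤ C₁ * rate n :=
      (div_le_div_of_nonneg_right (by linarith [(m n).cast_nonneg (α := ℝ)]) hn'.le).trans h3
    calc _ = varianceConst ρ σ η Λ (1 / c) * (m n / n) +
          thresholdConst η Λ c₂ * ρ * (1 / n) +
            d * ρ * (υ (m n + 1) / sobolevWeight p (m n + 1)) := by ring
      _ ≤ varianceConst ρ σ η Λ (1 / c) * (C₁ * rate n) +
          thresholdConst η Λ c₂ * ρ * (C₁ * rate n) + d * ρ * (C₂ * rate n) := by gcongr
      _ = _ := by ring

theorem polyWeight_pos (a : ℝ) (j : ℕ) : 0 < polyWeight a j := by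
  unfold polyWeight
  split_ifs with h
  · exact one_pos
  · exact Real.rpow_pos_of_pos (by exact_mod_cast (by omega : 0 < j)) _

theorem polyWeight_anti {a : ℝ} (ha : 0 ≤ a) {i j : ℕ} (hij : i ≤ j) :
    polyWeight a j ≤ polyWeight a i := by
  unfold polyWeight
  split_ifs with hj hi hi
  · rfl
  · omega
  · have : 1 ≤ j := by omega
    exact Real.rpow_le_one_of_one_le_of_nonpos (by exact_mod_cast this) (by linarith)
  · have : 0 < i := by omega
    exact Real.rpow_le_rpow_of_nonpos (by exact_mod_cast this) (by exact_mod_cast hij)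
      (by linarith)

theorem summable_polyWeight {a : ℝ} (ha : 1 / 2 < a) : Summable (polyWeight a) := by
  rw [← summable_nat_add_iff 2]
  refine ((summable_nat_add_iff 2).2
    (Real.summable_nat_rpow.2 (show -(2 * a) < -1 by linarith))).congr fun j => ?_
  rw [polyWeight, if_neg (by omega)]

theorem expWeight_pos (a : ℝ) (j : ℕ) : 0 < expWeight a j := by
  unfold expWeight
  split_ifs with h
  · exact one_pos
  · exact Real.exp_pos _

theorem expWeight_anti {a : ℝ} (ha : 0 ≤ a) {i j : ℕ} (hij : i ≤ j) :
    expWeight a j ≤ expWeight a i := by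
  unfold expWeight
  split_ifs with hj hi hi
  · rfl
  · omega
  · rw [Real.exp_le_one_iff, neg_nonpos]
    positivity
  · gcongr

theorem summable_expWeight {a : ℝ} (ha : 0 < a) : Summable (expWeight a) := by
  have ht : Tendsto (fun j : ℕ => (j : ℝ) ^ (2 * a)) atTop atTop :=
    (tendsto_rpow_atTop (by positivity)).comp tendsto_natCast_atTop_atTop
  have ho := (isLittleO_exp_neg_mul_rpow_atTop one_pos (-1 / a)).comp_tendsto ht
  refine summable_of_isBigO_nat (Real.summable_nat_rpow.2 (show (-2 : ℝ) < -1 by norm_num))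
    (ho.isBigO.congr' ?_ ?_)
  · filter_upwards [eventually_gt_atTop 1] with j hj
    rw [expWeight, if_neg (by omega)]
    simp
  · refine Eventually.of_forall fun j => ?_
    simp only [Function.comp]
    rw [← Real.rpow_mul (by positivity)]
    congr 1
    field_simp

theorem lesssim_add_one_div {m : ℕ → ℕ} {s rate : ℕ → ℝ}
    (hm : Lesssim (fun n => (m n : ℝ)) s) (hs : ∀ᶠ n in atTop, 1 ≤ s n)
    (hrate : ∀ᶠ n : ℕ in atTop, s n / n = rate n) :
    Lesssim (fun n => ((m n : ℝ) + 1) / n) rate := by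
  obtain ⟨C, hC, h⟩ := hm
  refine ⟨C + 1, by positivity, ?_⟩
  filter_upwards [h, hs, hrate] with n h1 h2 h3
  rw [← h3, ← mul_div_assoc]
  exact div_le_div_of_nonneg_right (by linarith) n.cast_nonneg

/-- For polynomial weights the quotient `υ_j / w_j` is of the order `j^{-(2p + 2a)}`. The factor
`3 ^ (2 * p)` accounts for the rounding in the index `⌊j / 2⌋` of the Sobolev weights. -/
theorem polyWeight_div_sobolevWeight_le {p : ℝ} (hp : 0 ≤ p) (a : ℝ) {j : ℕ} (hj : 2 ≤ j) :
    polyWeight a j / sobolevWeight p j ≤ 3 ^ (2 * p) * (j : ℝ) ^ (-(2 * p + 2 * a)) := by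
  have hj0 : (0 : ℝ) < j := by exact_mod_cast (by omega : 0 < j)
  rw [polyWeight, sobolevWeight, if_neg (by omega), if_neg (by omega)]
  have h : (j : ℝ) / 3 ≤ ((j / 2 : ℕ) : ℝ) := by
    rw [div_le_iff₀ (by norm_num)]
    exact_mod_cast (by omega : j ≤ j / 2 * 3)
  calc _ ≤ (j : ℝ) ^ (-(2 * a)) / ((j : ℝ) / 3) ^ (2 * p) := by gcongr
    _ = _ := by
      rw [Real.div_rpow hj0.le (by norm_num), neg_add, Real.rpow_add hj0,
        Real.rpow_neg hj0.le (2 * p)]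
      field_simp

theorem attainsRate_polyWeight {p ρ σ d η a : ℝ} {q : ℕ} (hp : 0 ≤ p) (hρ : 0 < ρ)
    (hd : 1 ≤ d) (hη : 1 ≤ η) (hq : 4 ≤ q) {m : ℕ → ℕ} {α : ℕ → ℝ}
    (hα : SameOrder α (fun n => 1 / (n : ℝ))) (ha : 1 / 2 < a)
    (hm : SameOrder (fun n => (m n : ℝ)) (fun n => (n : ℝ) ^ (1 / (2 * p + 2 * a + 1)))) :
    AttainsRate.{u} p ρ σ d η q (polyWeight a) m α
      (fun n => (n : ℝ) ^ (-((2 * p + 2 * a) / (2 * p + 2 * a + 1)))) := by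
  have hs : 0 < 2 * p + 2 * a + 1 := by linarith
  refine attainsRate_of_bounds hp hρ hd hη hq hα (polyWeight_pos a)
    (fun i j _ hij => polyWeight_anti (by linarith) hij) (summable_polyWeight ha)
    (lesssim_add_one_div hm.1 ?_ ?_) ?_
  · filter_upwards [eventually_ge_atTop 1] with n hn
    exact Real.one_le_rpow (by exact_mod_cast hn) (by positivity)
  · filter_upwards [eventually_ge_atTop 1] with n hn
    have hn0 : (0 : ℝ) < n := by exact_mod_cast hn
    rw [← Real.rpow_sub_one hn0.ne']
    congr 1
    field_simp
    ring
  · obtain ⟨C, hC, h⟩ := hm.2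
    refine ⟨3 ^ (2 * p) * C ^ (2 * p + 2 * a), by positivity, ?_⟩
    filter_upwards [h, eventually_ge_atTop 1] with n h hn
    have hn0 : (0 : ℝ) < n := by exact_mod_cast hn
    have hpos := Real.rpow_pos_of_pos hn0 (1 / (2 * p + 2 * a + 1))
    have hm1 : 1 ≤ m n := by
      by_contra hcon
      have h0 : m n = 0 := by omega
      rw [h0] at h
      simp only [Nat.cast_zero, mul_zero] at h
      linarith
    have hle : (n : ℝ) ^ (1 / (2 * p + 2 * a + 1)) / C ≤ ((m n + 1 : ℕ) : ℝ) := by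
      rw [div_le_iff₀' hC]
      push_cast
      linarith
    calc _ ≤ 3 ^ (2 * p) * ((m n + 1 : ℕ) : ℝ) ^ (-(2 * p + 2 * a)) :=
          polyWeight_div_sobolevWeight_le hp a (by omega)
      _ ≤ 3 ^ (2 * p) * ((n : ℝ) ^ (1 / (2 * p + 2 * a + 1)) / C) ^ (-(2 * p + 2 * a)) := by
          gcongr 3 ^ (2 * p) * ?_
          exact Real.rpow_le_rpow_of_nonpos (by positivity) hle (by linarith)
      _ = _ := by
          rw [Real.div_rpow hpos.le hC.le, ← Real.rpow_mul hn0.le, Real.rpow_neg hC.le,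
            div_inv_eq_mul, mul_assoc, mul_comm (C ^ _)]
          congr 3
          field_simp

theorem attainsRate_expWeight {p ρ σ d η a : ℝ} {q : ℕ} (hp : 0 ≤ p) (hρ : 0 < ρ)
    (hd : 1 ≤ d) (hη : 1 ≤ η) (hq : 4 ≤ q) {m : ℕ → ℕ} {α : ℕ → ℝ}
    (hα : SameOrder α (fun n => 1 / (n : ℝ))) (ha : 0 < a)
    (hm : SameOrder (fun n => (m n : ℝ)) (fun n => Real.log n ^ (1 / (2 * a))))
    (hbal : ∃ D : ℝ, 1 ≤ D ∧ ∀ᶠ n in atTop,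
      1 / D ≤ balance (sobolevWeight p) (expWeight a) (expWeight a) n (m n + 1)) :
    AttainsRate.{u} p ρ σ d η q (expWeight a) m α
      (fun n => (n : ℝ)⁻¹ * Real.log n ^ (1 / (2 * a))) := by
  have hvar : Lesssim (fun n => ((m n : ℝ) + 1) / n)
      (fun n => (n : ℝ)⁻¹ * Real.log n ^ (1 / (2 * a))) := by
    refine lesssim_add_one_div hm.1 ?_ (Eventually.of_forall fun n => by
      rw [div_eq_mul_inv, mul_comm])
    filter_upwards [(Real.tendsto_log_atTop.comp
      tendsto_natCast_atTop_atTop).eventually_ge_atTop 1] with n hn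
    exact Real.one_le_rpow hn (by positivity)
  refine attainsRate_of_bounds hp hρ hd hη hq hα (expWeight_pos a)
    (fun i j _ hij => expWeight_anti ha.le hij) (summable_expWeight ha) hvar ?_
  obtain ⟨C, hC, h⟩ := hvar
  obtain ⟨D, hD, hbal⟩ := hbal
  refine ⟨D * C, by positivity, ?_⟩
  filter_upwards [h, hbal, eventually_gt_atTop 0] with n h hb hn
  have hn0 : (0 : ℝ) < n := by exact_mod_cast hn
  have hυ := expWeight_pos a (m n + 1)
  have hw : 0 < sobolevWeight p (m n + 1) := one_pos.trans_le (one_le_sobolevWeight hp _)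
  -- the terms of the sum in `balance` are all equal to one
  have hsum : ∑ j ∈ Finset.Icc 1 (m n + 1), expWeight a j / expWeight a j = (m n : ℝ) + 1 := by
    rw [Finset.sum_congr rfl fun j _ => div_self (expWeight_pos a j).ne']
    simp
  rw [balance, hsum, div_mul_eq_mul_div, div_le_div_iff₀ (by positivity) (by positivity)] at hb
  calc expWeight a (m n + 1) / sobolevWeight p (m n + 1) ≤ D * (((m n : ℝ) + 1) / n) := by
        rw [mul_div_assoc', div_le_div_iff₀ hw hn0]
        linarith
    _ ≤ D * (C * ((n : ℝ)⁻¹ * Real.log n ^ (1 / (2 * a)))) := by gcongr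
    _ = _ := by ring

end FLM

theorem proposition4p2 (p ρ σ d η : ℝ) (k : ℕ)
    (hp : 0 ≤ p) (hρ : 0 < ρ) (hσ : 0 < σ) (hd : 1 ≤ d) (hη : 1 ≤ η) (hk : 4 ≤ k)
    (m : ℕ → ℕ) (α : ℕ → ℝ) (hα : FLM.SameOrder α (fun n => 1 / (n : ℝ))) :
    -- polynomial case
    (∀ a : ℝ, 1 / 2 < a →
      FLM.SameOrder (fun n => (m n : ℝ)) (fun n => (n : ℝ) ^ (1 / (2 * p + 2 * a + 1))) →
      FLM.AttainsRate.{u} p ρ σ d η (4 * k) (FLM.polyWeight a) m α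
        (fun n => (n : ℝ) ^ (-((2 * p + 2 * a) / (2 * p + 2 * a + 1))))) ∧
    -- exponential case
    (∀ a : ℝ, 0 < a →
      FLM.SameOrder (fun n => (m n : ℝ)) (fun n => Real.log n ^ (1 / (2 * a))) →
      (∃ D : ℝ, 1 ≤ D ∧ ∀ᶠ n in Filter.atTop,
        1 / D ≤ FLM.balance (FLM.sobolevWeight p) (FLM.expWeight a) (FLM.expWeight a) n
          (m n + 1)) →
      FLM.AttainsRate.{u} p ρ σ d η (4 * k) (FLM.expWeight a) m α
        (fun n => (n : ℝ)⁻¹ * Real.log n ^ (1 / (2 * a)))) :=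
  ⟨fun _ ha hm => FLM.attainsRate_polyWeight hp hρ hd hη (by omega) hα ha hm,
    fun _ ha hm hbal => FLM.attainsRate_expWeight hp hρ hd hη (by omega) hα ha hm hbal⟩
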